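/- Let $M$ be the complement of the figure-eight knot in $S^3$, with $$\pi_1(M)=\langle\alpha,\beta\mid \beta^{-1}\alpha^{-1}\beta\alpha\beta^{-1}\alpha\beta\alpha^{-1}\beta^{-1}\alpha\rangle ,$$ where $\alpha,\beta$ are meridians, and let $\lambda=\beta^{-1}\alpha\beta\alpha^{-1}\alpha^{-1}\beta\alpha\beta^{-1}$ be the longitude, so that $H_1(\partial M;\mathbb Z)=\mathbb Z\alpha\oplus\mathbb Z\lambda$. Let $X(M)\subset\mathbb C^3$ be the $SL_2(\mathbb C)$ character variety, i.e. the set of all triples $(\chi(\alpha),\chi(\beta),\chi(\alpha\beta))$, where $\chi$ runs over the characters of representations $\pi_1(M)\to SL_2(\mathbb C)$. Let $$X_0=\{(x,y,z)\in\mathbb C^3 : x=y,\ z^2-(1+x^2)z+2x^2-1=0\}.$$ Then $X_0$ is an irreducible component of $X(M)$, the character of every discrete faithful representation of $\pi_1(M)$ lies on $X_0$, and $X_0$ is the only irreducible component that contains such a character. For $\gamma=p\alpha+q\lambda\in H_1(\partial M;\mathbb Z)$ let $I_\gamma$ be the regular function on $X_0$ given by $I_\gamma(\chi)=\chi(\alpha^p\lambda^q)$,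 and put $f_\gamma=I_\gamma^2-4$, regarded as a meromorphic function on the smooth projective model $\widetilde X_0$ of $X_0$. Let $\deg f_\gamma$ be its number of poles counted with multiplicity (so the degree of $f_\gamma$ as a map $\widetilde X_0\to\mathbb{CP}^1$, and $0$ if $f_\gamma$ is constant). An ideal point is a point of $\widetilde X_0$ at which some regular function on $X_0$ has a pole. There are exactly two ideal points $P_0\neq P_1$, and, labelled suitably, for all $p,q\in\mathbb Z$ the pole orders of $f_{p\alpha+q\lambda}$ at $P_0$ and $P_1$ are $2|p+4q|$ and $2|p-4q|$ respectively (in particular $f_\alpha$ has order $2$ and $f_\lambda$ has order $8$ at both). There is exactly one norm $|\cdot|$ on $H_1(\partial M;\mathbb R)$ with $|\gamma|=\deg f_\gamma$ for all $\gamma\in H_1(\partial M;\mathbb Z)$, the Culler–Shalen norm, and for all $p,q\in\mathbb Z$ $$|p\alpha+q\lambda|=2\bigl(|p+4q|+|p-4q|\bigr).$$ -/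

import Mathlib

open MvPolynomial

noncomputable section

/-- An irreducible closed affine algebraic subset of `ℂⁿ`. -/
structure AffineVariety (n : ℕ) where
  carrier : Set (Fin n → ℂ)
  closed : zeroLocus ℂ (vanishingIdeal ℂ carrier) = carrier
  prime : (vanishingIdeal ℂ carrier).IsPrime

namespace AffineVariety

variable {n : ℕ} (X : AffineVariety n)

/-- The vanishing ideal of the variety. -/
abbrev ideal : Ideal (MvPolynomial (Fin n) ℂ) := vanishingIdeal ℂ X.carrier

instance : X.ideal.IsPrime := X.prime

/-- The ring of regular functions. -/
abbrev CoordinateRing : Type := MvPolynomial (Fin n) ℂ ⧸ X.ideal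

/-- The field of rational functions. -/
abbrev FunctionField : Type := FractionRing X.CoordinateRing

/-- `X` is an irreducible component of the subset `W` of `ℂⁿ`: a maximal irreducible closed
algebraic subset of `ℂⁿ` among those contained in `W`. -/
def IsComponentOf (W : Set (Fin n → ℂ)) : Prop :=
  X.carrier ⊆ W ∧
    ∀ Y : AffineVariety n, X.carrier ⊆ Y.carrier → Y.carrier ⊆ W → Y.carrier = X.carrier

end AffineVariety

/-- A place of an extension `K / ℂ`: a discrete valuation ring of `K` that contains `ℂ` (its field
of fractions is `K`, since it is a valuation ring of `K`). When `K` is the function field of a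
curve, the places are the points of the smooth projective model of that curve, and the valuation
ring is the local ring at the point. -/
structure Place (K : Type) [Field K] [Algebra ℂ K] where
  ring : ValuationSubring K
  const_mem : ∀ c : ℂ, algebraMap ℂ K c ∈ ring
  dvr : IsDiscreteValuationRing ring

namespace Place

variable {K : Type} [Field K] [Algebra ℂ K] (P : Place K)

instance : IsDiscreteValuationRing P.ring := P.dvr

open scoped Classical in
/-- The order of the pole of `f` at `P`, which is `0` if `f` is regular at `P`; if `f` has a pole
at `P`, it is the order of vanishing of `f⁻¹` at `P`. -/
def poleOrder (f : K) : ℕ :=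
  if h : f ∈ P.ring then 0
  else (IsDiscreteValuationRing.addVal P.ring
    ⟨f⁻¹, (P.ring.mem_or_inv_mem f).resolve_left h⟩).toNat

end Place

/-- The degree of an element `f` of the function field of a curve, viewed as a holomorphic map
from the smooth projective model to the projective line: the number of poles of `f`, counted with
multiplicity. It is `0` for a constant `f`. -/
def meromorphicDegree {K : Type} [Field K] [Algebra ℂ K] (f : K) : ℕ :=
  ∑ᶠ P : Place K, P.poleOrder f

/-- `P` is an ideal point of `X`: a point of the smooth projective model that does not lie over a
point of `X`, i.e. at which not all regular functions on `X` are regular. -/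
def AffineVariety.IsIdealPoint {n : ℕ} (X : AffineVariety n) (P : Place X.FunctionField) : Prop :=
  ∃ a : X.CoordinateRing, algebraMap X.CoordinateRing X.FunctionField a ∉ P.ring

namespace FigureEight

/-- The relator `b⁻¹ a⁻¹ b a b⁻¹ a b a⁻¹ b⁻¹ a`. -/
def relator : FreeGroup (Fin 2) :=
  let a := FreeGroup.of 0
  let b := FreeGroup.of 1
  b⁻¹ * a⁻¹ * b * a * b⁻¹ * a * b * a⁻¹ * b⁻¹ * a

/-- The fundamental group of the complement of the figure-eight knot. -/
abbrev KnotGroup : Type := PresentedGroup ({relator} : Set (FreeGroup (Fin 2)))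

/-- The meridian. -/
def α : KnotGroup := PresentedGroup.of 0

/-- A second meridian, conjugate to `α`. -/
def β : KnotGroup := PresentedGroup.of 1

/-- The longitude; `α` and `longitude` generate the peripheral subgroup `ℤ ⊕ ℤ`. -/
def longitude : KnotGroup := β⁻¹ * α * β * α⁻¹ * α⁻¹ * β * α * β⁻¹

/-- The peripheral element with class `p α + q λ` in the first homology of the boundary torus. -/
def peripheral (p q : ℤ) : KnotGroup := α ^ p * longitude ^ q

abbrev SL2 : Type := Matrix.SpecialLinearGroup (Fin 2) ℂ

/-- The character of `ρ` in the coordinates `(χ(α), χ(β), χ(αβ))`, which determine it. -/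
def character (ρ : KnotGroup →* SL2) : Fin 3 → ℂ :=
  ![(ρ α).1.trace, (ρ β).1.trace, (ρ (α * β)).1.trace]

/-- The `SL₂(ℂ)`-character variety of the knot complement, as a subset of `ℂ³`. -/
def characterVariety : Set (Fin 3 → ℂ) := Set.range character

/-- `ρ` is faithful and its image is a discrete subgroup of `SL₂(ℂ)`. -/
def IsDiscreteFaithful (ρ : KnotGroup →* SL2) : Prop :=
  Function.Injective ρ ∧ DiscreteTopology ρ.range

theorem exists_matrix_expansion (g : KnotGroup) :
    ∃ p q r s : MvPolynomial (Fin 3) ℂ, ∀ ρ : KnotGroup →* SL2,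
      (ρ g).1 = eval (character ρ) p • (1 : Matrix (Fin 2) (Fin 2) ℂ) +
        eval (character ρ) q • (ρ α).1 + eval (character ρ) r • (ρ β).1 +
        eval (character ρ) s • ((ρ α).1 * (ρ β).1) := by
  have sq : ∀ A : SL2, A.1 * A.1 = A.1.trace • A.1 - 1 := by
    intro A
    have hA := A.2
    rw [Matrix.det_fin_two] at hA
    ext i j
    fin_cases i <;> fin_cases j <;>
      simp [Matrix.mul_apply, Fin.sum_univ_two, Matrix.trace_fin_two] <;>
      first | ring1 | linear_combination -hA
  have swap : ∀ A B : Matrix (Fin 2) (Fin 2) ℂ, B * A = -(A * B) + B.trace • A + A.trace • B +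
      ((A * B).trace - A.trace * B.trace) • (1 : Matrix (Fin 2) (Fin 2) ℂ) := by
    intro A B
    ext i j
    fin_cases i <;> fin_cases j <;>
      simp [Matrix.mul_apply, Fin.sum_univ_two, Matrix.trace_fin_two] <;> ring
  have inv : ∀ A : SL2, (A⁻¹).1 = A.1.trace • (1 : Matrix (Fin 2) (Fin 2) ℂ) - A.1 := by
    intro A
    rw [Matrix.SpecialLinearGroup.coe_inv, Matrix.adjugate_fin_two]
    ext i j
    fin_cases i <;> fin_cases j <;> simp [Matrix.trace_fin_two]
  have mulA : ∀ (A B : SL2) (p q r s : ℂ),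
      (p • (1 : Matrix (Fin 2) (Fin 2) ℂ) + q • A.1 + r • B.1 + s • (A.1 * B.1)) * A.1 =
        (-q + r * ((A.1 * B.1).trace - A.1.trace * B.1.trace) - s * B.1.trace) •
            (1 : Matrix (Fin 2) (Fin 2) ℂ) +
          (p + q * A.1.trace + r * B.1.trace + s * (A.1 * B.1).trace) • A.1 +
          (r * A.1.trace + s) • B.1 + (-r) • (A.1 * B.1) := by
    intro A B p q r s
    simp only [add_mul, Matrix.smul_mul, Matrix.one_mul, Matrix.mul_assoc]
    rw [swap A.1 B.1]
    simp only [mul_add, mul_neg, Matrix.mul_smul, ← Matrix.mul_assoc, sq, Matrix.mul_one, sub_mul,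
      Matrix.smul_mul, Matrix.one_mul]
    module
  have mulB : ∀ (A B : SL2) (p q r s : ℂ),
      (p • (1 : Matrix (Fin 2) (Fin 2) ℂ) + q • A.1 + r • B.1 + s • (A.1 * B.1)) * B.1 =
        (-r) • (1 : Matrix (Fin 2) (Fin 2) ℂ) + (-s) • A.1 + (p + r * B.1.trace) • B.1 +
          (q + s * B.1.trace) • (A.1 * B.1) := by
    intro A B p q r s
    simp only [add_mul, Matrix.smul_mul, Matrix.one_mul, Matrix.mul_assoc, sq, mul_sub,
      Matrix.mul_smul, Matrix.mul_one]
    module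
  have h0 : ∀ ρ, character ρ 0 = (ρ α).1.trace := fun _ => rfl
  have h1 : ∀ ρ, character ρ 1 = (ρ β).1.trace := fun _ => rfl
  have h2 : ∀ ρ, character ρ 2 = ((ρ α).1 * (ρ β).1).trace := fun ρ => by simp [character]
  have hg : g ∈ Subgroup.closure (Set.range (PresentedGroup.of (rels := {relator}))) := by
    rw [PresentedGroup.closure_range_of]; trivial
  induction hg using Subgroup.closure_induction_right with
  | one => exact ⟨1, 0, 0, 0, fun ρ => by simp⟩
  | mul_right g _ y hy ih =>
    obtain ⟨p, q, r, s, h⟩ := ih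
    obtain ⟨i, rfl⟩ := hy
    fin_cases i
    · refine ⟨-q + r * (X 2 - X 0 * X 1) - s * X 1, p + q * X 0 + r * X 1 + s * X 2,
        r * X 0 + s, -r, fun ρ => ?_⟩
      change (ρ (g * α)).1 = _
      rw [map_mul, Matrix.SpecialLinearGroup.coe_mul, h, mulA]
      simp only [map_add, map_sub, map_mul, map_neg, eval_X, h0, h1, h2]
    · refine ⟨-r, -s, p + r * X 1, q + s * X 1, fun ρ => ?_⟩
      change (ρ (g * β)).1 = _
      rw [map_mul, Matrix.SpecialLinearGroup.coe_mul, h, mulB]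
      simp only [map_add, map_mul, map_neg, eval_X, h1]
  | mul_inv_cancel g _ y hy ih =>
    obtain ⟨p, q, r, s, h⟩ := ih
    obtain ⟨i, rfl⟩ := hy
    fin_cases i
    · refine ⟨X 0 * p - (-q + r * (X 2 - X 0 * X 1) - s * X 1),
        X 0 * q - (p + q * X 0 + r * X 1 + s * X 2),
        X 0 * r - (r * X 0 + s), X 0 * s - (-r), fun ρ => ?_⟩
      change (ρ (g * α⁻¹)).1 = _
      rw [map_mul, map_inv, Matrix.SpecialLinearGroup.coe_mul, inv, mul_sub, h, mulA]
      simp only [map_add, map_sub, map_mul, map_neg, eval_X, h0, h1, h2, Matrix.mul_smul,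
        Matrix.mul_one]
      module
    · refine ⟨X 1 * p - (-r), X 1 * q - (-s), X 1 * r - (p + r * X 1),
        X 1 * s - (q + s * X 1), fun ρ => ?_⟩
      change (ρ (g * β⁻¹)).1 = _
      rw [map_mul, map_inv, Matrix.SpecialLinearGroup.coe_mul, inv, mul_sub, h, mulB]
      simp only [map_add, map_sub, map_mul, map_neg, eval_X, h1, Matrix.mul_smul,
        Matrix.mul_one]
      module

theorem exists_tracePolynomial (g : KnotGroup) :
    ∃ F : MvPolynomial (Fin 3) ℂ, ∀ ρ : KnotGroup →* SL2,
      eval (character ρ) F = (ρ g).1.trace := by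
  obtain ⟨p, q, r, s, h⟩ := exists_matrix_expansion g
  refine ⟨C 2 * p + X 0 * q + X 1 * r + X 2 * s, fun ρ => ?_⟩
  rw [h ρ]
  simp [character, Matrix.trace_add, Matrix.trace_smul]
  ring

/-- The regular function `I_g` on a subvariety `X` of the character variety, whose value at the
character of `ρ` is the trace of `ρ g`. -/
def traceFunction (X : AffineVariety 3) (g : KnotGroup) : X.CoordinateRing :=
  Ideal.Quotient.mk X.ideal (exists_tracePolynomial g).choose

/-- The function `f_g = I_g ^ 2 - 4` as a rational function on `X`. -/
def f (X : AffineVariety 3) (g : KnotGroup) : X.FunctionField :=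
  algebraMap X.CoordinateRing X.FunctionField (traceFunction X g ^ 2 - 4)

/-- `N` is the Culler–Shalen norm of `X` on `H₁(∂M; ℝ)`, where `(s, t)` stands for `s α + t λ`:
a norm with `N γ = deg f_γ` for every integral class `γ`. -/
structure IsCullerShalenNorm (X : AffineVariety 3) (N : Seminorm ℝ (ℝ × ℝ)) : Prop where
  definite : ∀ v, N v = 0 → v = 0
  eq_degree : ∀ p q : ℤ, N ((p : ℝ), (q : ℝ)) = meromorphicDegree (f X (peripheral p q))

end FigureEight

end

/-! Everything rests on one identity. For `A`, `B` in `SL₂` with common trace `x` and `tr AB = z`,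
the two sides of the knot relation differ by `φ(x, z) (A - B)`, where `φ` is the Riley polynomial
(`relation_sub`). So a character lies on `φ = 0`, or else `A = B` and `z = x² - 2`; conversely each
point of `φ = 0` is a character. If `z = x² - 2`, the commutators `[A, B]` and `[A, B⁻¹]` commute,
which fails in the knot group, as a representation over the field with 7 elements shows. Hence the
character of a faithful representation lies only on the curve `φ = 0`.

With `w = 2z - 1 - x²` the curve is `w² = (x² - 1)(x² - 5)`. It is irreducible because this
discriminant is not a square. At infinity put `x = s⁻¹ + s`, with `s⁻¹` an eigenvalue of the
meridian; the two square roots of the discriminant give two embeddings of the function field into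
Laurent series in `s`, hence two places. No other place is ideal: in `u = 1/x`, `v = w/x²` the curve
is smooth at `(0, ±1)` with parameter `u`, so every nonzero function is a power of `u` times a unit
there (`hasUniformFactorization`).

The trace identity `I_{gh} + I_{gh⁻¹} = I_g I_h` is a linear recurrence in `p` and in `q`. It gives
`I_γ = E + E⁻¹` with `E = s^{-p} ℓ^q`, where `ℓ` is the eigenvalue of the longitude, so `f_γ = (E -
E⁻¹)²`. Since `ℓ` has a pole of order 4 on one branch and a zero of order 4 on the other, the pole
orders are `2|p ± 4q|`. Their sum is the degree, and a seminorm on the plane is determined by its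
values at integral points. -/

noncomputable section

namespace FigureEight

/-! ### Words in two matrices of `SL₂` with equal traces -/

section Words

variable {R : Type*} [CommRing R]

/-- The relation between the traces `x = tr A = tr B` and `z = tr (A B)` that characterizes the
pairs `A ≠ B` satisfying the relation of the knot group. -/
def rileyPolynomial (x z : R) : R := z ^ 2 - (1 + x ^ 2) * z + 2 * x ^ 2 - 1

/-- The combination `p + q A + r B + s A B`. -/
def combination (A B : Matrix (Fin 2) (Fin 2) R) (p q r s : R) : Matrix (Fin 2) (Fin 2) R :=
  p • 1 + q • A + r • B + s • (A * B)

theorem coe_inv_eq (A : Matrix.SpecialLinearGroup (Fin 2) R) :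
    (A⁻¹).1 = A.1.trace • (1 : Matrix (Fin 2) (Fin 2) R) - A.1 := by
  rw [Matrix.SpecialLinearGroup.coe_inv, Matrix.adjugate_fin_two]
  ext i j
  fin_cases i <;> fin_cases j <;> simp [Matrix.trace_fin_two]

theorem coe_mul_self (A : Matrix.SpecialLinearGroup (Fin 2) R) :
    A.1 * A.1 = A.1.trace • A.1 - 1 := by
  have hA := A.2
  rw [Matrix.det_fin_two] at hA
  ext i j
  fin_cases i <;> fin_cases j <;>
    simp [Matrix.mul_apply, Fin.sum_univ_two, Matrix.trace_fin_two] <;>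
    first | ring1 | linear_combination -hA

/-- The polarized Cayley–Hamilton identity. With `coe_mul_self` it makes the span of `1, A, B, AB`
closed under right multiplication by both generators. -/
theorem mul_swap (A B : Matrix (Fin 2) (Fin 2) R) :
    B * A = -(A * B) + B.trace • A + A.trace • B +
      ((A * B).trace - A.trace * B.trace) • (1 : Matrix (Fin 2) (Fin 2) R) := by
  ext i j
  fin_cases i <;> fin_cases j <;>
    simp [Matrix.mul_apply, Fin.sum_univ_two, Matrix.trace_fin_two] <;> ring

variable (A B : Matrix.SpecialLinearGroup (Fin 2) R) {x z : R}

/-- This rule and the next three let `simp` evaluate any word letter by letter. All multiply on the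
right; the names say whether the letter is the left generator `A` or the right one `B`. -/
theorem combination_mul_left (hA : A.1.trace = x) (hB : B.1.trace = x)
    (hAB : (A.1 * B.1).trace = z) (p q r s : R) :
    combination A.1 B.1 p q r s * A.1 =
    combination A.1 B.1 (-q + r * (z - x * x) - s * x) (p + q * x + r * x + s * z) (r * x + s)
      (-r) := by
  simp only [combination, add_mul, Matrix.smul_mul, Matrix.one_mul, Matrix.mul_assoc]
  rw [mul_swap A.1 B.1]
  simp only [mul_add, mul_neg, Matrix.mul_smul, ← Matrix.mul_assoc, coe_mul_self, Matrix.mul_one,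
    sub_mul, Matrix.smul_mul, Matrix.one_mul, hA, hB, hAB]
  module

theorem combination_mul_right (hB : B.1.trace = x) (p q r s : R) :
    combination A.1 B.1 p q r s * B.1 =
    combination A.1 B.1 (-r) (-s) (p + r * x) (q + s * x) := by
  simp only [combination, add_mul, Matrix.smul_mul, Matrix.one_mul, Matrix.mul_assoc,
    coe_mul_self, mul_sub, Matrix.mul_smul, Matrix.mul_one, hB]
  module

theorem combination_mul_left_inv (hA : A.1.trace = x) (hB : B.1.trace = x)
    (hAB : (A.1 * B.1).trace = z) (p q r s : R) :
    combination A.1 B.1 p q r s * (A⁻¹).1 =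
    combination A.1 B.1 (x * p - (-q + r * (z - x * x) - s * x))
      (x * q - (p + q * x + r * x + s * z)) (x * r - (r * x + s)) (x * s - -r) := by
  rw [coe_inv_eq, mul_sub, combination_mul_left A B hA hB hAB, hA]
  simp only [combination, Matrix.mul_smul, Matrix.mul_one]
  module

theorem combination_mul_right_inv (hB : B.1.trace = x) (p q r s : R) :
    combination A.1 B.1 p q r s * (B⁻¹).1 =
    combination A.1 B.1 (x * p - -r) (x * q - -s) (x * r - (p + r * x)) (x * s - (q + s * x)) := by
  rw [coe_inv_eq, mul_sub, combination_mul_right A B hB, hB]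
  simp only [combination, Matrix.mul_smul, Matrix.mul_one]
  module

theorem trace_combination (hA : A.1.trace = x) (hB : B.1.trace = x)
    (hAB : (A.1 * B.1).trace = z) (p q r s : R) :
   
    (combination A.1 B.1 p q r s).trace = 2 * p + x * q + x * r + z * s := by
  simp [combination, Matrix.trace_add, Matrix.trace_smul, hA, hB, hAB]
  ring

theorem one_eq_combination : (1 : Matrix (Fin 2) (Fin 2) R) = combination A.1 B.1 1 0 0 0 := by
  simp [combination]

theorem relation_sub (hA : A.1.trace = x) (hB : B.1.trace = x)
    (hAB : (A.1 * B.1).trace = z) :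
    (B⁻¹ * A⁻¹ * B * A * B⁻¹).1 - (A⁻¹ * B * A * B⁻¹ * A⁻¹).1 =
    rileyPolynomial x z • (A.1 - B.1) := by
  have h1 : (B⁻¹ * A⁻¹ * B * A * B⁻¹).1 =
      1 * (B⁻¹).1 * (A⁻¹).1 * B.1 * A.1 * (B⁻¹).1 := by simp
  have h2 : (A⁻¹ * B * A * B⁻¹ * A⁻¹).1 =
      1 * (A⁻¹).1 * B.1 * A.1 * (B⁻¹).1 * (A⁻¹).1 := by simp
  rw [h1, h2, one_eq_combination A B]
  simp only [combination_mul_left A B hA hB hAB, combination_mul_right A B hB,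
    combination_mul_left_inv A B hA hB hAB, combination_mul_right_inv A B hB]
  simp only [combination, rileyPolynomial]
  module

theorem relation_iff (hA : A.1.trace = x) (hB : B.1.trace = x)
    (hAB : (A.1 * B.1).trace = z) :
    B⁻¹ * A⁻¹ * B * A * B⁻¹ * A * B * A⁻¹ * B⁻¹ * A = 1 ↔
    rileyPolynomial x z • (A.1 - B.1) = 0 := by
  -- Splitting the relator into two halves of length five turns it into the equation whose defect is
  -- `relation_sub`.
  have h : B⁻¹ * A⁻¹ * B * A * B⁻¹ * A * B * A⁻¹ * B⁻¹ * A =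
      B⁻¹ * A⁻¹ * B * A * B⁻¹ * (A⁻¹ * B * A * B⁻¹ * A⁻¹)⁻¹ := by group
  rw [← relation_sub A B hA hB hAB, sub_eq_zero, h]
  exact mul_inv_eq_one.trans Subtype.ext_iff

theorem trace_longitude (hA : A.1.trace = x) (hB : B.1.trace = x)
    (hAB : (A.1 * B.1).trace = z)
    (h : rileyPolynomial x z = 0) :
    (B⁻¹ * A * B * A⁻¹ * A⁻¹ * B * A * B⁻¹).1.trace = x ^ 4 - 5 * x ^ 2 + 2 := by
  have h1 : (B⁻¹ * A * B * A⁻¹ * A⁻¹ * B * A * B⁻¹).1 =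
      1 * (B⁻¹).1 * A.1 * B.1 * (A⁻¹).1 * (A⁻¹).1 * B.1 * A.1 * (B⁻¹).1 := by simp
  rw [h1, one_eq_combination A B]
  simp only [combination_mul_left A B hA hB hAB, combination_mul_right A B hB,
    combination_mul_left_inv A B hA hB hAB, combination_mul_right_inv A B hB,
    trace_combination A B hA hB hAB]
  rw [rileyPolynomial] at h
  -- The coefficient is the quotient on division by the Riley polynomial.
  linear_combination (z * x ^ 2 - x ^ 4 + 3 * x ^ 2) * h

/-- The traces of meridian and longitude leave open which eigenvalue of one goes with which of the
other; the trace of the product decides. -/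
theorem trace_mul_longitude (hA : A.1.trace = x) (hB : B.1.trace = x)
    (hAB : (A.1 * B.1).trace = z)
    (h : rileyPolynomial x z = 0) :
    (A * (B⁻¹ * A * B * A⁻¹ * A⁻¹ * B * A * B⁻¹)).1.trace =
      z * (4 * x - x ^ 3) + x ^ 5 - 4 * x ^ 3 - x := by
  have h1 : (A * (B⁻¹ * A * B * A⁻¹ * A⁻¹ * B * A * B⁻¹)).1 =
      1 * A.1 * (B⁻¹).1 * A.1 * B.1 * (A⁻¹).1 * (A⁻¹).1 * B.1 * A.1 * (B⁻¹).1 := by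
    simp [mul_assoc]
  rw [h1, one_eq_combination A B]
  simp only [combination_mul_left A B hA hB hAB, combination_mul_right A B hB,
    combination_mul_left_inv A B hA hB hAB, combination_mul_right_inv A B hB,
    trace_combination A B hA hB hAB]
  rw [rileyPolynomial] at h
  linear_combination (-z ^ 2 * x + 2 * z * x ^ 3 - 2 * z * x - x ^ 5 + 2 * x ^ 3 + 2 * x) * h

/-- Over a field `N = u vᵀ`, so the middle of `N X N` collapses to the scalar `vᵀ X u`. -/
theorem mul_mul_self_of_det_eq_zero {N : Matrix (Fin 2) (Fin 2) R} (hN : N.det = 0)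
    (X : Matrix (Fin 2) (Fin 2) R) : N * X * N = (N * X).trace • N := by
  rw [Matrix.det_fin_two] at hN
  ext i j
  fin_cases i <;> fin_cases j <;>
    simp [Matrix.mul_apply, Fin.sum_univ_two, Matrix.trace_fin_two]
  · linear_combination (-X 1 1) * hN
  · linear_combination (X 0 1) * hN
  · linear_combination (X 1 0) * hN
  · linear_combination (-X 0 0) * hN

/-- This is Fricke's formula: the right side is `2 - tr [A, B]`, which vanishes for reducible pairs.
-/
theorem det_sub_mul (A B : Matrix (Fin 2) (Fin 2) R) (hA : A.det = 1) (hB : B.det = 1) :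
    (A * B - B * A).det = 4 + A.trace * B.trace * (A * B).trace - A.trace ^ 2 - B.trace ^ 2 -
      (A * B).trace ^ 2 := by
  rw [Matrix.det_fin_two] at hA hB
  simp [Matrix.det_fin_two, Matrix.mul_apply, Fin.sum_univ_two, Matrix.trace_fin_two]
  grind

/-- If `z = x ^ 2 - 2`, the pair `A`, `B` is reducible, and commutators commute. -/
theorem commute_commutators (hA : A.1.trace = x) (hB : B.1.trace = x)
    (hAB : (A.1 * B.1).trace = z) (h : z = x ^ 2 - 2) :
    Commute (A * B * A⁻¹ * B⁻¹) (A * B⁻¹ * A⁻¹ * B) := by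
  have hN : (A.1 * B.1 - B.1 * A.1).det = 0 := by
    rw [det_sub_mul _ _ A.2 B.2, hA, hB, hAB, h]
    ring
  set N := A.1 * B.1 - B.1 * A.1 with hN'
  -- Both commutators are the identity plus a multiple of the same singular matrix `N`.
  have e1 : (A * B * A⁻¹ * B⁻¹).1 = 1 + N * ((A⁻¹).1 * (B⁻¹).1) := by
    have : B * A * (A⁻¹ * B⁻¹) = 1 := by group
    have := congrArg Subtype.val this
    simp only [Matrix.SpecialLinearGroup.coe_mul, Matrix.SpecialLinearGroup.coe_one] at this ⊢
    rw [hN', sub_mul, this]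
    simp [mul_assoc]
  have e2 : (A * B⁻¹ * A⁻¹ * B).1 = 1 - N * ((A⁻¹).1 * B.1) := by
    have h1 : B⁻¹ * A * (A⁻¹ * B) = 1 := by group
    have h1 := congrArg Subtype.val h1
    simp only [Matrix.SpecialLinearGroup.coe_mul, Matrix.SpecialLinearGroup.coe_one] at h1 ⊢
    have h2 : A.1 * (B⁻¹).1 - (B⁻¹).1 * A.1 = -N := by
      rw [coe_inv_eq, hN', mul_sub, sub_mul]
      simp
    rw [sub_eq_iff_eq_add] at h2
    rw [mul_assoc _ _ B.1, h2, add_mul, h1, neg_mul, sub_eq_add_neg, add_comm]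
  have t1 : (N * ((A⁻¹).1 * (B⁻¹).1)).trace = 0 := by
    have : N * ((A⁻¹).1 * (B⁻¹).1) = (A * B * A⁻¹ * B⁻¹).1 - 1 := by rw [e1]; simp
    have h1 : (A * B * A⁻¹ * B⁻¹).1 = 1 * A.1 * B.1 * (A⁻¹).1 * (B⁻¹).1 := by simp
    rw [this, h1, Matrix.trace_sub, Matrix.trace_one]
    nth_rewrite 1 [one_eq_combination A B]
    simp only [combination_mul_left A B hA hB hAB, combination_mul_right A B hB,
      combination_mul_left_inv A B hA hB hAB, combination_mul_right_inv A B hB,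
      trace_combination A B hA hB hAB, Fintype.card_fin, h]
    push_cast
    ring
  have t2 : (N * ((A⁻¹).1 * B.1)).trace = 0 := by
    have : N * ((A⁻¹).1 * B.1) = 1 - (A * B⁻¹ * A⁻¹ * B).1 := by rw [e2]; simp
    have h1 : (A * B⁻¹ * A⁻¹ * B).1 = 1 * A.1 * (B⁻¹).1 * (A⁻¹).1 * B.1 := by simp
    rw [this, h1, Matrix.trace_sub, Matrix.trace_one]
    nth_rewrite 1 [one_eq_combination A B]
    simp only [combination_mul_left A B hA hB hAB, combination_mul_right A B hB,
      combination_mul_left_inv A B hA hB hAB, combination_mul_right_inv A B hB,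
      trace_combination A B hA hB hAB, Fintype.card_fin, h]
    push_cast
    ring
  -- Both commutators have trace 2, so the scalars in `N U N` and `N V N` vanish and the cross terms
  -- of the two products drop out.
  have f1 : N * ((A⁻¹).1 * (B⁻¹).1) * N = 0 := by
    rw [mul_mul_self_of_det_eq_zero hN, t1, zero_smul]
  have f2 : N * ((A⁻¹).1 * B.1) * N = 0 := by
    rw [mul_mul_self_of_det_eq_zero hN, t2, zero_smul]
  apply Subtype.ext
  change (A * B * A⁻¹ * B⁻¹).1 * (A * B⁻¹ * A⁻¹ * B).1 =
    (A * B⁻¹ * A⁻¹ * B).1 * (A * B * A⁻¹ * B⁻¹).1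
  rw [e1, e2]
  generalize (A⁻¹).1 * (B⁻¹).1 = U at *
  generalize (A⁻¹).1 * B.1 = V at *
  have g1 : N * U * (N * V) = 0 := by rw [← mul_assoc, f1, zero_mul]
  have g2 : N * V * (N * U) = 0 := by rw [← mul_assoc, f2, zero_mul]
  simp only [add_mul, mul_sub, sub_mul, mul_add, one_mul, mul_one, g1, g2]
  abel

end Words

/-! ### Representations of the knot group -/

section Representations

variable {R : Type} [CommRing R]

theorem relation_knotGroup :
    β⁻¹ * α⁻¹ * β * α * β⁻¹ * α * β * α⁻¹ * β⁻¹ * α = 1 :=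
  PresentedGroup.one_of_mem (Set.mem_singleton relator)

/-- The representation of the knot group with `α ↦ A` and `β ↦ B`. -/
def representation (A B : Matrix.SpecialLinearGroup (Fin 2) R)
    (h : B⁻¹ * A⁻¹ * B * A * B⁻¹ * A * B * A⁻¹ * B⁻¹ * A = 1) :
    KnotGroup →* Matrix.SpecialLinearGroup (Fin 2) R :=
  PresentedGroup.toGroup (f := ![A, B]) (by
    rintro r rfl
    simpa [relator] using h)

theorem representation_α (A B : Matrix.SpecialLinearGroup (Fin 2) R) (h) :
    representation A B h α = A := by
  simp [representation, α]

theorem representation_β (A B : Matrix.SpecialLinearGroup (Fin 2) R) (h) :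
    representation A B h β = B := by
  simp [representation, β]

theorem trace_β_eq_trace_α (ρ : KnotGroup →* Matrix.SpecialLinearGroup (Fin 2) R) :
    (ρ β).1.trace = (ρ α).1.trace := by
  have h : (α * β⁻¹ * α⁻¹ * β) * α * (α * β⁻¹ * α⁻¹ * β)⁻¹ = β := by
    calc _ = α * (β⁻¹ * α⁻¹ * β * α * β⁻¹ * α * β * α⁻¹ * β⁻¹ * α) * (α⁻¹ * β) := by group
      _ = β := by rw [relation_knotGroup]; group
  rw [← h, map_mul, map_mul, Matrix.SpecialLinearGroup.coe_mul, Matrix.trace_mul_comm,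
    ← Matrix.SpecialLinearGroup.coe_mul, map_inv, inv_mul_cancel_left]

theorem not_commute_commutators :
    ¬ Commute (α * β * α⁻¹ * β⁻¹) (α * β⁻¹ * α⁻¹ * β) := by
  intro h
  -- A parabolic representation: for `x = 2`, `z = 2 + t` the Riley polynomial is `t² - t + 1`,
  -- which has the root `t = 3` modulo 7.
  let A : Matrix.SpecialLinearGroup (Fin 2) (ZMod 7) := ⟨!![1, 1; 0, 1], by decide⟩
  let B : Matrix.SpecialLinearGroup (Fin 2) (ZMod 7) := ⟨!![1, 0; 3, 1], by decide⟩
  have hAB : B⁻¹ * A⁻¹ * B * A * B⁻¹ * A * B * A⁻¹ * B⁻¹ * A = 1 := by decide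
  have h := h.map (representation A B hAB)
  simp only [map_mul, map_inv, representation_α, representation_β] at h
  revert h
  unfold Commute SemiconjBy
  decide

theorem α_ne_β : α ≠ β := fun h => not_commute_commutators (by simp [h])

end Representations

/-! ### Characters and the curve -/

section CharacterVariety

/-- The points of the component of the character variety that carries the irreducible
representations. -/
def canonicalSet : Set (Fin 3 → ℂ) :=
  {v | v 0 = v 1 ∧ v 2 ^ 2 - (1 + v 0 ^ 2) * v 2 + 2 * v 0 ^ 2 - 1 = 0}

theorem mem_canonicalSet_iff {v : Fin 3 → ℂ} :
    v ∈ canonicalSet ↔ v 0 = v 1 ∧ rileyPolynomial (v 0) (v 2) = 0 := Iff.rfl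

theorem character_one (ρ : KnotGroup →* SL2) : character ρ 1 = character ρ 0 :=
  trace_β_eq_trace_α ρ

theorem character_two (ρ : KnotGroup →* SL2) :
    ((ρ α).1 * (ρ β).1).trace = character ρ 2 := by
  simp [character]

theorem rileyPolynomial_smul_eq_zero (ρ : KnotGroup →* SL2) :
    rileyPolynomial (character ρ 0) (character ρ 2) • ((ρ α).1 - (ρ β).1) = 0 := by
  refine (relation_iff (ρ α) (ρ β) rfl (character_one ρ) (character_two ρ)).mp ?_
  simpa using congrArg ρ relation_knotGroup

theorem mem_canonicalSet_of_ne (ρ : KnotGroup →* SL2) (h : ρ α ≠ ρ β) :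
    character ρ ∈ canonicalSet := by
  rw [mem_canonicalSet_iff]
  refine ⟨(character_one ρ).symm, ?_⟩
  rcases smul_eq_zero.mp (rileyPolynomial_smul_eq_zero ρ) with h0 | h0
  · exact h0
  · exact absurd (Subtype.ext (sub_eq_zero.mp h0)) h

theorem character_two_of_eq (ρ : KnotGroup →* SL2) (h : ρ α = ρ β) :
    character ρ 2 = character ρ 0 ^ 2 - 2 := by
  rw [← character_two, ← h, coe_mul_self, Matrix.trace_sub, Matrix.trace_smul, Matrix.trace_one,
    Fintype.card_fin]
  change character ρ 0 * character ρ 0 - _ = _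
  push_cast
  ring

theorem character_two_ne_of_injective (ρ : KnotGroup →* SL2) (h : Function.Injective ρ) :
    character ρ 2 ≠ character ρ 0 ^ 2 - 2 := by
  intro h0
  have := commute_commutators (ρ α) (ρ β) rfl (character_one ρ) (character_two ρ) h0
  refine not_commute_commutators (h ?_)
  simpa using this.eq

theorem exists_traces (x y z : ℂ) : ∃ A B : SL2, A.1.trace = x ∧ B.1.trace = y ∧
    (A.1 * B.1).trace = z := by
  -- The matrices below have `tr AB = u + u⁻¹`.
  obtain ⟨u, hu⟩ : ∃ u : ℂ, u ^ 2 - z * u + 1 = 0 := by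
    obtain ⟨w, hw⟩ := IsAlgClosed.exists_pow_nat_eq (z ^ 2 - 4) (n := 2) (by norm_num)
    exact ⟨(z + w) / 2, by linear_combination hw / 4⟩
  have hu0 : u ≠ 0 := by
    rintro rfl
    simp at hu
  refine ⟨⟨!![x, -1; 1, 0], by simp [Matrix.det_fin_two]⟩,
    ⟨!![0, u; -u⁻¹, y], by simp [Matrix.det_fin_two, hu0]⟩, ?_, ?_, ?_⟩
  · simp [Matrix.trace_fin_two]
  · simp [Matrix.trace_fin_two]
  · simp [Matrix.trace_fin_two]
    field_simp
    linear_combination hu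

theorem exists_character_eq {v : Fin 3 → ℂ} (hv : v ∈ canonicalSet) :
    ∃ ρ : KnotGroup →* SL2, character ρ = v := by
  obtain ⟨h1, h2⟩ := mem_canonicalSet_iff.mp hv
  obtain ⟨A, B, hA, hB, hAB⟩ := exists_traces (v 0) (v 0) (v 2)
  refine ⟨representation A B ((relation_iff A B hA hB hAB).mpr (by rw [h2, zero_smul])), ?_⟩
  ext i
  fin_cases i
  · simp [character, representation_α, hA]
  · simp [character, representation_β, hB, h1]
  · simp [character, representation_α, representation_β, hAB]

theorem trace_longitude_eq (ρ : KnotGroup →* SL2) (h : character ρ ∈ canonicalSet) :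
    (ρ longitude).1.trace = character ρ 0 ^ 4 - 5 * character ρ 0 ^ 2 + 2 := by
  refine Eq.trans ?_ (trace_longitude (ρ α) (ρ β) rfl (character_one ρ) (character_two ρ)
    (mem_canonicalSet_iff.mp h).2)
  simp only [longitude, map_mul, map_inv]

theorem trace_mul_longitude_eq (ρ : KnotGroup →* SL2) (h : character ρ ∈ canonicalSet) :
    (ρ (α * longitude)).1.trace = character ρ 2 * (4 * character ρ 0 - character ρ 0 ^ 3) +
      character ρ 0 ^ 5 - 4 * character ρ 0 ^ 3 - character ρ 0 := by
  refine Eq.trans ?_ (trace_mul_longitude (ρ α) (ρ β) rfl (character_one ρ) (character_two ρ)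
    (mem_canonicalSet_iff.mp h).2)
  simp only [longitude, map_mul, map_inv]

end CharacterVariety

end FigureEight

namespace FigureEight

/-! ### Normal forms of polynomial functions on the curve -/

section Polynomials

/-- The discriminant `(T ^ 2 - 1) (T ^ 2 - 5)` of the equation of the curve over the `x`-line. -/
def discriminant : Polynomial ℂ :=
  (Polynomial.X - Polynomial.C 1) * ((Polynomial.X + 1) * (Polynomial.X ^ 2 - 5))

theorem aeval_discriminant {R : Type*} [CommRing R] [Algebra ℂ R] (x : R) :
    Polynomial.aeval x discriminant = x ^ 4 - 6 * x ^ 2 + 5 := by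
  simp [discriminant, map_ofNat]
  ring

/-- The discriminant has a simple root at 1, so the multiplicities of that root on the two sides
would have different parity. -/
theorem eq_zero_of_sq_eq_sq_mul_discriminant {c b : Polynomial ℂ}
    (h : c ^ 2 = b ^ 2 * discriminant) : c = 0 ∧ b = 0 := by
  suffices hb : b = 0 by
    refine ⟨?_, hb⟩
    rw [hb, zero_pow two_ne_zero, zero_mul] at h
    exact pow_eq_zero_iff two_ne_zero |>.mp h
  by_contra hb
  have hE : ((Polynomial.X + 1) * (Polynomial.X ^ 2 - 5) : Polynomial ℂ).eval 1 ≠ 0 := by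
    norm_num
  have hE0 : ((Polynomial.X + 1) * (Polynomial.X ^ 2 - 5) : Polynomial ℂ) ≠ 0 := by
    intro h0
    simp [h0] at hE
  have hX : (Polynomial.X - Polynomial.C 1 : Polynomial ℂ) ≠ 0 := Polynomial.X_sub_C_ne_zero 1
  have hc : c ≠ 0 := by
    rintro rfl
    rw [zero_pow two_ne_zero] at h
    exact mul_ne_zero (pow_ne_zero 2 hb) (mul_ne_zero hX hE0) h.symm
  have := congrArg (Polynomial.rootMultiplicity 1) h
  rw [sq, Polynomial.rootMultiplicity_mul (mul_ne_zero hc hc), discriminant,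
    Polynomial.rootMultiplicity_mul (mul_ne_zero (pow_ne_zero 2 hb) (mul_ne_zero hX hE0)),
    Polynomial.rootMultiplicity_mul (mul_ne_zero hX hE0), sq,
    Polynomial.rootMultiplicity_mul (mul_ne_zero hb hb),
    Polynomial.rootMultiplicity_X_sub_C_self, Polynomial.rootMultiplicity_eq_zero hE] at this
  omega

/-- On the curve, every polynomial function has the form `a(x) + b(x) z`. -/
theorem exists_normalForm (P : MvPolynomial (Fin 3) ℂ) :
    ∃ a b : Polynomial ℂ, ∀ (R : Type) [CommRing R] [Algebra ℂ R] (x z : R),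
      rileyPolynomial x z = 0 →
        aeval ![x, x, z] P = Polynomial.aeval x a + Polynomial.aeval x b * z := by
  induction P using MvPolynomial.induction_on with
  | C c => exact ⟨Polynomial.C c, 0, fun R _ _ x z _ => by simp⟩
  | add P Q hP hQ =>
    obtain ⟨a, b, h⟩ := hP
    obtain ⟨a', b', h'⟩ := hQ
    refine ⟨a + a', b + b', fun R _ _ x z hz => ?_⟩
    rw [map_add, h R x z hz, h' R x z hz, map_add, map_add]
    ring
  | mul_X P i hP =>
    obtain ⟨a, b, h⟩ := hP
    have hx : ∃ a' b' : Polynomial ℂ, ∀ (R : Type) [CommRing R] [Algebra ℂ R] (x z : R),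
        rileyPolynomial x z = 0 →
          aeval ![x, x, z] P * x = Polynomial.aeval x a' + Polynomial.aeval x b' * z := by
      refine ⟨a * Polynomial.X, b * Polynomial.X, fun R _ _ x z hz => ?_⟩
      rw [h R x z hz, map_mul, map_mul, Polynomial.aeval_X]
      ring
    fin_cases i
    · simpa using hx
    · simpa using hx
    · refine ⟨b * (1 - 2 * Polynomial.X ^ 2), a + b * (1 + Polynomial.X ^ 2),
        fun R _ _ x z hz => ?_⟩
      rw [map_mul, h R x z hz]
      simp [map_ofNat]
      rw [rileyPolynomial] at hz
      linear_combination Polynomial.aeval x b * hz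

/-- The norm of `a(x) + b(x) z` down to the `x`-line, up to a factor `4`. -/
theorem normalForm_norm {R : Type*} [CommRing R] [Algebra ℂ R] {x z : R}
    (hz : rileyPolynomial x z = 0) (a b : Polynomial ℂ)
    (h : Polynomial.aeval x a + Polynomial.aeval x b * z = 0) :
    Polynomial.aeval x ((2 * a + b * (1 + Polynomial.X ^ 2)) ^ 2) =
      Polynomial.aeval x (b ^ 2 * discriminant) := by
  rw [map_mul, aeval_discriminant]
  simp [map_ofNat]
  rw [rileyPolynomial] at hz
  linear_combination 4 * (Polynomial.aeval x a + Polynomial.aeval x b * (1 + x ^ 2 - z)) * h +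
    4 * Polynomial.aeval x b ^ 2 * hz

theorem normalForm_eq_zero {a b : Polynomial ℂ}
    (h : (2 * a + b * (1 + Polynomial.X ^ 2)) ^ 2 = b ^ 2 * discriminant) : a = 0 ∧ b = 0 := by
  obtain ⟨h1, rfl⟩ := eq_zero_of_sq_eq_sq_mul_discriminant h
  simpa using h1

end Polynomials

/-! ### Irreducibility of the curve -/

section VanishingIdeal

theorem eq_of_mem_canonicalSet {v : Fin 3 → ℂ} (hv : v ∈ canonicalSet) :
    v = ![v 0, v 0, v 2] := by
  ext i
  fin_cases i
  · rfl
  · exact hv.1.symm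
  · rfl

theorem exists_rileyPolynomial_eq_zero (x : ℂ) : ∃ z : ℂ, rileyPolynomial x z = 0 := by
  obtain ⟨w, hw⟩ := IsAlgClosed.exists_pow_nat_eq (x ^ 4 - 6 * x ^ 2 + 5) (n := 2) (by norm_num)
  refine ⟨(1 + x ^ 2 + w) / 2, ?_⟩
  rw [rileyPolynomial]
  linear_combination hw / 4

/-- A generic point of the curve: its defining equation holds and `x` is transcendental. -/
theorem mem_vanishingIdeal_iff_aeval_eq_zero {R : Type} [CommRing R] [Algebra ℂ R] {x z : R}
    (hx : Transcendental ℂ x) (hz : rileyPolynomial x z = 0) (P : MvPolynomial (Fin 3) ℂ) :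
    P ∈ vanishingIdeal ℂ canonicalSet ↔ aeval ![x, x, z] P = 0 := by
  obtain ⟨a, b, h⟩ := exists_normalForm P
  rw [mem_vanishingIdeal_iff]
  constructor
  · intro hP
    have h0 : (2 * a + b * (1 + Polynomial.X ^ 2)) ^ 2 = b ^ 2 * discriminant := by
      refine Polynomial.funext fun t => ?_
      obtain ⟨z, hz⟩ := exists_rileyPolynomial_eq_zero t
      have hv : ![t, t, z] ∈ canonicalSet := ⟨rfl, hz⟩
      have := normalForm_norm hz a b (by rw [← h ℂ t z hz]; exact hP _ hv)
      simpa only [Polynomial.coe_aeval_eq_eval] using this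
    obtain ⟨rfl, rfl⟩ := normalForm_eq_zero h0
    simp [h R x z hz]
  · intro hP v hv
    rw [h R x z hz] at hP
    -- Transcendence of `x` turns an equation between values into one between polynomials.
    have h0 := transcendental_iff_injective.mp hx (normalForm_norm hz a b hP)
    obtain ⟨rfl, rfl⟩ := normalForm_eq_zero h0
    rw [eq_of_mem_canonicalSet hv, h ℂ (v 0) (v 2) hv.2]
    simp

/-- The ideal is the kernel of evaluation at a generic point with coordinates in a domain. -/
theorem isPrime_vanishingIdeal {R : Type} [CommRing R] [IsDomain R] [Algebra ℂ R] {x z : R}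
    (hx : Transcendental ℂ x) (hz : rileyPolynomial x z = 0) :
    (vanishingIdeal ℂ canonicalSet).IsPrime := by
  have : vanishingIdeal ℂ canonicalSet =
      RingHom.ker (aeval ![x, x, z] : MvPolynomial (Fin 3) ℂ →ₐ[ℂ] R) := by
    ext P
    exact mem_vanishingIdeal_iff_aeval_eq_zero hx hz P
  rw [this]
  exact RingHom.ker_isPrime _

theorem zeroLocus_vanishingIdeal_canonicalSet :
    zeroLocus ℂ (vanishingIdeal ℂ canonicalSet) = canonicalSet := by
  refine Set.Subset.antisymm (fun v hv => ?_) (zeroLocus_vanishingIdeal_le _)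
  have h1 := hv (X 0 - X 1) (by
    rw [mem_vanishingIdeal_iff]
    intro v hv
    simp [hv.1])
  have h2 := hv (rileyPolynomial (X 0) (X 2)) (by
    rw [mem_vanishingIdeal_iff]
    intro v hv
    simpa [rileyPolynomial] using hv.2)
  refine mem_canonicalSet_iff.mpr ⟨?_, ?_⟩
  · simpa [sub_eq_zero] using h1
  · simpa [rileyPolynomial] using h2

end VanishingIdeal

/-! ### Laurent expansions at infinity -/

section LaurentSeries

open scoped PowerSeries LaurentSeries
open WithZero LaurentSeries

instance : CharZero ℂ⸨X⸩ := charZero_of_injective_algebraMap (algebraMap ℂ ℂ⸨X⸩).injective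

/-- The two square roots of `1 - 2 s ^ 2 - s ^ 4 - 2 s ^ 6 + s ^ 8`; they correspond to the two
points at infinity of the curve, where `s ^ (-1) + s` is the coordinate `x`. -/
abbrev Branch : Type :=
  {r : ℂ⟦X⟧ // r ^ 2 = 1 - 2 * (PowerSeries.X : ℂ⟦X⟧) ^ 2 - .X ^ 4 - 2 * .X ^ 6 + .X ^ 8}

theorem exists_branch : ∃ r : Branch, PowerSeries.constantCoeff (R := ℂ) r.1 = 1 := by
  let g : ℂ⟦X⟧ := 1 - 2 * (PowerSeries.X : ℂ⟦X⟧) ^ 2 - .X ^ 4 - 2 * .X ^ 6 + .X ^ 8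
  let f : Polynomial ℂ⟦X⟧ := Polynomial.X ^ 2 - Polynomial.C g
  have hf : f.Monic := Polynomial.monic_X_pow_sub_C g two_ne_zero
  -- Hensel lifts the simple root 1 modulo `s`.
  obtain ⟨r, h1, h2⟩ := HenselianRing.is_henselian (I := Ideal.span {(PowerSeries.X : ℂ⟦X⟧)}) f hf 1
    (by
      simp only [f, g, Polynomial.eval_sub, Polynomial.eval_pow, Polynomial.eval_X,
        Polynomial.eval_C, Ideal.mem_span_singleton]
      exact ⟨2 * .X + .X ^ 3 + 2 * .X ^ 5 - .X ^ 7, by ring⟩)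
    (by
      apply IsUnit.map
      simp only [f, Polynomial.derivative_sub, Polynomial.derivative_X_pow, Polynomial.derivative_C,
        sub_zero, PowerSeries.isUnit_iff_constantCoeff]
      simp [map_ofNat])
  refine ⟨⟨r, ?_⟩, ?_⟩
  · simpa [f, g, sub_eq_zero] using h1
  · rw [Ideal.mem_span_singleton, PowerSeries.X_dvd_iff] at h2
    simpa [sub_eq_zero] using h2

instance : Neg Branch := ⟨fun r => ⟨-r.1, by rw [neg_sq, r.2]⟩⟩

namespace Branch

variable (r : Branch)

/-- The sign that distinguishes the two branches. -/
def sign : ℂ := PowerSeries.constantCoeff (R := ℂ) r.1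

theorem sign_sq : r.sign ^ 2 = 1 := by
  have := congrArg (PowerSeries.constantCoeff (R := ℂ)) r.2
  simpa [sign] using this

theorem sign_neg : (-r).sign = -r.sign := by
  change PowerSeries.constantCoeff (R := ℂ) (-r.1) = _
  simp [sign]

/-- The local parameter. -/
def s : ℂ⸨X⸩ := ((PowerSeries.X : ℂ⟦X⟧) : ℂ⸨X⸩)

/-- The Laurent expansion of the coordinate `x`. -/
def x : ℂ⸨X⸩ := s⁻¹ + s

/-- The Laurent expansion of `2 z - 1 - x ^ 2`. -/
def w : ℂ⸨X⸩ := s⁻¹ ^ 2 * (r.1 : ℂ⸨X⸩)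

/-- The Laurent expansion of the coordinate `z`. -/
def z : ℂ⸨X⸩ := (1 + x ^ 2 + r.w) / 2

theorem s_ne_zero : s ≠ 0 := by
  rw [s, PowerSeries.coe_X]
  simp

theorem val_s : Valued.v s = exp (-1 : ℤ) := by
  have := valuation_X_pow ℂ 1
  simpa [s] using this

theorem val_coe_le_one (g : ℂ⟦X⟧) : Valued.v (g : ℂ⸨X⸩) ≤ (1 : ℤᵐ⁰) :=
  (val_le_one_iff_eq_coe ℂ _).mpr ⟨g, rfl⟩

theorem val_coe_lt_one {g : ℂ⟦X⟧} (hg : PowerSeries.constantCoeff (R := ℂ) g = 0) :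
    Valued.v (g : ℂ⸨X⸩) < (1 : ℤᵐ⁰) := by
  obtain ⟨h, rfl⟩ := PowerSeries.X_dvd_iff.mpr hg
  rw [PowerSeries.coe_mul, map_mul]
  refine mul_lt_one_of_lt_of_le ?_ (val_coe_le_one h)
  rw [← s, val_s, ← exp_zero, exp_lt_exp]
  norm_num

theorem val_coe_eq_one {g : ℂ⟦X⟧} (hg : PowerSeries.constantCoeff (R := ℂ) g ≠ 0) :
    Valued.v (g : ℂ⸨X⸩) = (1 : ℤᵐ⁰) := by
  have hu : IsUnit g := PowerSeries.isUnit_iff_constantCoeff.mpr hg.isUnit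
  obtain ⟨h, hh⟩ := hu.exists_right_inv
  refine le_antisymm (val_coe_le_one g) ?_
  have h1 : Valued.v (g : ℂ⸨X⸩) * Valued.v (h : ℂ⸨X⸩) = (1 : ℤᵐ⁰) := by
    rw [← map_mul, ← PowerSeries.coe_mul, hh, PowerSeries.coe_one, map_one]
  by_contra h2
  exact absurd h1 (mul_lt_one_of_lt_of_le (not_le.mp h2) (val_coe_le_one h)).ne

theorem algebraMap_eq_coe (c : ℂ) : algebraMap ℂ ℂ⸨X⸩ c = ((PowerSeries.C c : ℂ⟦X⟧) : ℂ⸨X⸩) := by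
  rw [PowerSeries.coe_C, LaurentSeries.algebraMap_apply]

theorem val_algebraMap_le_one (c : ℂ) : Valued.v (algebraMap ℂ ℂ⸨X⸩ c) ≤ (1 : ℤᵐ⁰) := by
  rw [algebraMap_eq_coe]
  exact val_coe_le_one _

theorem x_eq : x = s⁻¹ * ((1 + .X ^ 2 : ℂ⟦X⟧) : ℂ⸨X⸩) := by
  have := s_ne_zero
  rw [x, PowerSeries.coe_add, PowerSeries.coe_one, PowerSeries.coe_pow, ← s]
  field_simp

theorem val_x : Valued.v x = exp (1 : ℤ) := by
  rw [x_eq, map_mul, map_inv₀, val_s, val_coe_eq_one (by simp), mul_one, exp_neg, inv_inv]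

/-- An algebraic element is integral over the constants, hence lies in the valuation ring, but `x`
has a pole. -/
theorem transcendental_x : Transcendental ℂ x := by
  intro h
  have h1 : x ∈ (Valued.v : Valuation ℂ⸨X⸩ ℤᵐ⁰).valuationSubring := by
    have : IsIntegral (Valued.v : Valuation ℂ⸨X⸩ ℤᵐ⁰).valuationSubring x := by
      obtain ⟨p, hp, hp0⟩ := h.isIntegral
      let φ : ℂ →+* (Valued.v : Valuation ℂ⸨X⸩ ℤᵐ⁰).valuationSubring :=
        (algebraMap ℂ ℂ⸨X⸩).codRestrict _ val_algebraMap_le_one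
      refine ⟨p.map φ, hp.map φ, ?_⟩
      rw [Polynomial.eval₂_map]
      exact hp0
    obtain ⟨y, hy⟩ := IsIntegrallyClosed.isIntegral_iff.mp this
    rw [← hy]
    exact y.2
  rw [Valuation.mem_valuationSubring_iff, val_x, ← exp_zero, exp_le_exp] at h1
  norm_num at h1

theorem w_sq : r.w ^ 2 = x ^ 4 - 6 * x ^ 2 + 5 := by
  have h : (r.1 : ℂ⸨X⸩) ^ 2 = 1 - 2 * s ^ 2 - s ^ 4 - 2 * s ^ 6 + s ^ 8 := by
    have := congrArg (HahnSeries.ofPowerSeries ℤ ℂ) r.2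
    simpa only [map_pow, map_sub, map_add, map_mul, map_one, map_ofNat, s] using this
  have hs := s_ne_zero
  rw [w, mul_pow, h, x]
  field_simp
  ring

theorem rileyPolynomial_eq_zero : rileyPolynomial x r.z = 0 := by
  rw [rileyPolynomial, z]
  linear_combination r.w_sq / 4

end Branch

end LaurentSeries

end FigureEight

/-! ### Places attached to discrete valuations -/

namespace Place

open WithZero

variable {K : Type} [Field K] (v : Valuation K ℤᵐ⁰)

theorem isUnit_valuationSubring_iff {a : v.valuationSubring} : IsUnit a ↔ v a = 1 := by
  constructor
  · rintro ⟨u, rfl⟩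
    have h : v (u : v.valuationSubring) * v (u⁻¹ : v.valuationSubringˣ).1 = 1 := by
      rw [← map_mul, ← MulMemClass.coe_mul, Units.mul_inv]
      exact map_one v
    refine le_antisymm u.1.2 ?_
    by_contra h2
    exact absurd h (mul_lt_one_of_lt_of_le (not_le.mp h2) (u⁻¹).1.2).ne
  · intro h
    have h0 : (a : K) ≠ 0 := by
      intro h0
      simp [h0] at h
    refine IsUnit.of_mul_eq_one ⟨(a : K)⁻¹, ?_⟩ (Subtype.ext (mul_inv_cancel₀ h0))
    rw [Valuation.mem_valuationSubring_iff, map_inv₀, h, inv_one]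

theorem le_exp_neg_one_of_lt_one {a : ℤᵐ⁰} (h : a < 1) : a ≤ exp (-1 : ℤ) := by
  rcases eq_or_ne a 0 with rfl | h0
  · exact zero_le
  · rw [← exp_log h0] at h ⊢
    rw [← exp_zero, exp_lt_exp] at h
    rw [exp_le_exp]
    omega

theorem irreducible_of_valuation_eq {ϖ : v.valuationSubring} (hϖ : v ϖ = exp (-1 : ℤ)) :
    Irreducible ϖ := by
  refine ⟨fun h => ?_, fun a b hab => ?_⟩
  · rw [isUnit_valuationSubring_iff, hϖ, exp_eq_one] at h
    omega
  · by_contra h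
    rw [not_or, isUnit_valuationSubring_iff, isUnit_valuationSubring_iff] at h
    have h1 := le_exp_neg_one_of_lt_one (lt_of_le_of_ne a.2 h.1)
    have h2 := le_exp_neg_one_of_lt_one (lt_of_le_of_ne b.2 h.2)
    have h3 : v a * v b = exp (-1 : ℤ) := by
      rw [← hϖ, hab, ← map_mul]
      rfl
    have h4 := mul_le_mul' h1 h2
    rw [h3, ← exp_add, exp_le_exp] at h4
    omega

theorem exists_unit_mul_pow {ϖ : v.valuationSubring} (hϖ : v ϖ = exp (-1 : ℤ))
    {a : v.valuationSubring} {n : ℕ} (h : v a = exp (-n : ℤ)) :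
    ∃ u : v.valuationSubringˣ, a = u * ϖ ^ n := by
  have h0 : (ϖ : K) ≠ 0 := by
    intro h0
    rw [h0, map_zero] at hϖ
    exact exp_ne_zero hϖ.symm
  have h1 : v ((a : K) / ϖ ^ n) = 1 := by
    rw [map_div₀, map_pow, hϖ, h, ← exp_nsmul, ← exp_sub]
    simp
  obtain ⟨u, hu⟩ := (isUnit_valuationSubring_iff v
    (a := ⟨(a : K) / ϖ ^ n, (Valuation.mem_valuationSubring_iff _ _).mpr h1.le⟩)).mpr h1
  refine ⟨u, Subtype.ext ?_⟩
  rw [hu]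
  exact (div_mul_cancel₀ _ (pow_ne_zero n h0)).symm

variable [Algebra ℂ K]

/-- The place attached to a normalized discrete valuation that is trivial on the constants. -/
def ofValuation (hc : ∀ c : ℂ, v (algebraMap ℂ K c) ≤ 1) (hv : ∃ ϖ, v ϖ = exp (-1 : ℤ)) :
    Place K where
  ring := v.valuationSubring
  const_mem := hc
  dvr := by
    obtain ⟨ϖ, hϖ⟩ := hv
    have hϖ1 : ϖ ∈ v.valuationSubring := by
      rw [Valuation.mem_valuationSubring_iff, hϖ, ← exp_zero, exp_le_exp]
      omega
    refine IsDiscreteValuationRing.ofHasUnitMulPowIrreducibleFactorization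
      ⟨⟨ϖ, hϖ1⟩, irreducible_of_valuation_eq v hϖ, fun {a} ha => ?_⟩
    have ha0 : v (a : K) ≠ 0 := by simpa using ha
    have ha1 : v (a : K) ≤ 1 := a.2
    rw [← exp_log ha0, ← exp_zero, exp_le_exp] at ha1
    obtain ⟨n, hn⟩ := Int.eq_ofNat_of_zero_le (neg_nonneg.mpr ha1)
    obtain ⟨u, hu⟩ := exists_unit_mul_pow v (ϖ := ⟨ϖ, hϖ1⟩) hϖ (a := a) (n := n) (by
      rw [← exp_log ha0]
      congr 1
      omega)
    exact ⟨n, u, by rw [hu, mul_comm]⟩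

theorem mem_ring_ofValuation (hc hv) (a : K) : a ∈ (ofValuation v hc hv).ring ↔ v a ≤ 1 := Iff.rfl

theorem poleOrder_eq_zero {P : Place K} {a : K} (h : a ∈ P.ring) : P.poleOrder a = 0 := by
  rw [poleOrder, dif_pos h]

theorem poleOrder_ofValuation (hc) (hv : ∃ ϖ, v ϖ = exp (-1 : ℤ)) (a : K) {n : ℕ}
    (hn : v a = exp (n : ℤ)) : (ofValuation v hc hv).poleOrder a = n := by
  obtain ⟨ϖ, hϖ⟩ := id hv
  have hϖ1 : ϖ ∈ (ofValuation v hc hv).ring := by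
    rw [mem_ring_ofValuation, hϖ, ← exp_zero, exp_le_exp]
    omega
  rcases Nat.eq_zero_or_pos n with rfl | h0
  · refine poleOrder_eq_zero ?_
    rw [mem_ring_ofValuation, hn]
    simp
  have ha : a ∉ (ofValuation v hc hv).ring := by
    rw [mem_ring_ofValuation, hn, ← exp_zero, exp_le_exp]
    omega
  rw [poleOrder, dif_neg ha]
  set a' : (ofValuation v hc hv).ring := ⟨a⁻¹, _⟩
  obtain ⟨u, hu⟩ := exists_unit_mul_pow v (ϖ := ⟨ϖ, hϖ1⟩) hϖ (a := a') (n := n) (by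
    change v a⁻¹ = _
    rw [map_inv₀, hn, exp_neg])
  rw [IsDiscreteValuationRing.addVal_def (R := (ofValuation v hc hv).ring) a' u
    (irreducible_of_valuation_eq v (ϖ := ⟨ϖ, hϖ1⟩) hϖ) n hu]
  rfl

theorem ext_ring {P Q : Place K} (h : P.ring = Q.ring) : P = Q := by
  cases P
  cases Q
  simpa using h

end Place

/-! ### The function field and its two points at infinity -/

namespace FigureEight

open WithZero
open scoped LaurentSeries

/-- The component of the character variety that carries the irreducible representations. -/
def curve : AffineVariety 3 where
  carrier := canonicalSet
  closed := zeroLocus_vanishingIdeal_canonicalSet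
  prime := isPrime_vanishingIdeal Branch.transcendental_x
    exists_branch.choose.rileyPolynomial_eq_zero

namespace Branch

variable (r : Branch)

/-- The expansion of regular functions at a point at infinity. -/
def expand : curve.CoordinateRing →ₐ[ℂ] ℂ⸨X⸩ :=
  Ideal.Quotient.liftₐ curve.ideal (aeval ![x, x, r.z]) fun P hP =>
    (mem_vanishingIdeal_iff_aeval_eq_zero transcendental_x r.rileyPolynomial_eq_zero P).mp hP

theorem expand_mk (P : MvPolynomial (Fin 3) ℂ) :
    r.expand (Ideal.Quotient.mk curve.ideal P) = aeval ![x, x, r.z] P := rfl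

theorem expand_injective : Function.Injective r.expand := by
  rw [injective_iff_map_eq_zero]
  intro a ha
  obtain ⟨P, rfl⟩ := Ideal.Quotient.mk_surjective a
  rw [expand_mk, ← mem_vanishingIdeal_iff_aeval_eq_zero transcendental_x
    r.rileyPolynomial_eq_zero] at ha
  exact Ideal.Quotient.eq_zero_iff_mem.mpr ha

/-- The Laurent expansion of rational functions at a point at infinity. -/
def laurent : curve.FunctionField →ₐ[ℂ] ℂ⸨X⸩ :=
  IsFractionRing.liftAlgHom r.expand_injective

theorem laurent_algebraMap (a : curve.CoordinateRing) :
    r.laurent (algebraMap _ _ a) = r.expand a :=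
  IsFractionRing.lift_algebraMap r.expand_injective a

/-- The order of rational functions at a point at infinity. -/
def val : Valuation curve.FunctionField ℤᵐ⁰ :=
  (Valued.v : Valuation ℂ⸨X⸩ ℤᵐ⁰).comap r.laurent.toRingHom

theorem val_apply (a : curve.FunctionField) : r.val a = Valued.v (r.laurent a) := rfl

end Branch

/-- The coordinate `x` as a rational function. -/
def xFun : curve.FunctionField := algebraMap curve.CoordinateRing _ (Ideal.Quotient.mk _ (X 0))

/-- The coordinate `z` as a rational function. -/
def zFun : curve.FunctionField := algebraMap curve.CoordinateRing _ (Ideal.Quotient.mk _ (X 2))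

/-- The square root `2 z - 1 - x ^ 2` of the discriminant. -/
def wFun : curve.FunctionField := 2 * zFun - 1 - xFun ^ 2

namespace Branch

variable (r : Branch)

theorem laurent_xFun : r.laurent xFun = x := by
  rw [xFun, laurent_algebraMap, expand_mk]
  simp

theorem laurent_zFun : r.laurent zFun = r.z := by
  rw [zFun, laurent_algebraMap, expand_mk]
  simp

theorem laurent_wFun : r.laurent wFun = r.w := by
  rw [wFun, map_sub, map_sub, map_mul, map_pow, laurent_xFun, laurent_zFun, map_one, map_ofNat, z]
  ring

theorem val_algebraMap_le (c : ℂ) : r.val (algebraMap ℂ _ c) ≤ 1 := by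
  rw [val_apply, AlgHom.commutes]
  exact val_algebraMap_le_one c

theorem val_xFun : r.val xFun = exp (1 : ℤ) := by
  rw [val_apply, laurent_xFun, val_x]

theorem val_xFun_inv : r.val xFun⁻¹ = exp (-1 : ℤ) := by
  rw [map_inv₀, val_xFun, exp_neg]

/-- The point at infinity given by a branch. -/
def place : Place curve.FunctionField :=
  Place.ofValuation r.val r.val_algebraMap_le ⟨_, r.val_xFun_inv⟩

theorem mem_place_ring_iff (a : curve.FunctionField) : a ∈ r.place.ring ↔ r.val a ≤ 1 := Iff.rfl

end Branch

theorem xFun_ne_zero : xFun ≠ 0 := by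
  obtain ⟨r, -⟩ := exists_branch
  intro h
  have := r.val_xFun
  rw [h, map_zero] at this
  exact exp_ne_zero this.symm

theorem wFun_sq : wFun ^ 2 = xFun ^ 4 - 6 * xFun ^ 2 + 5 := by
  obtain ⟨r, -⟩ := exists_branch
  apply r.laurent.toRingHom.injective
  change r.laurent _ = r.laurent _
  rw [map_pow, r.laurent_wFun, r.w_sq]
  simp [r.laurent_xFun, map_ofNat]

/-- The coordinate `1 / x` near infinity. -/
def uFun : curve.FunctionField := xFun⁻¹

/-- The coordinate `(2 z - 1 - x ^ 2) / x ^ 2` near infinity. -/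
def vFun : curve.FunctionField := wFun * uFun ^ 2

theorem uFun_ne_zero : uFun ≠ 0 := inv_ne_zero xFun_ne_zero

theorem vFun_sq : vFun ^ 2 = 1 - 6 * uFun ^ 2 + 5 * uFun ^ 4 := by
  have := xFun_ne_zero
  rw [vFun, mul_pow, wFun_sq, uFun]
  field_simp

/-- In the expansion `v = r / (1 + s²)²`, whose value at `s = 0` is the constant term of `r`. -/
theorem Branch.val_vFun_sub (r : Branch) :
    r.val (vFun - algebraMap ℂ _ r.sign) < 1 := by
  rw [Branch.val_apply, map_sub, vFun, uFun, map_mul, map_pow, map_inv₀, r.laurent_wFun,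
    r.laurent_xFun, AlgHom.commutes, Branch.algebraMap_eq_coe, Branch.w, Branch.x_eq]
  have h0 : ((1 + .X ^ 2 : PowerSeries ℂ) : ℂ⸨X⸩) ≠ 0 := by
    intro h
    have := Branch.val_coe_eq_one (g := 1 + .X ^ 2) (by simp)
    simp [h] at this
  have h1 : Branch.s⁻¹ ^ 2 * (r.1 : ℂ⸨X⸩) * (Branch.s⁻¹ * ((1 + .X ^ 2 : PowerSeries ℂ) : ℂ⸨X⸩))⁻¹ ^ 2 -
      ((PowerSeries.C r.sign : PowerSeries ℂ) : ℂ⸨X⸩) =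
      ((r.1 - PowerSeries.C r.sign * (1 + .X ^ 2) ^ 2 : PowerSeries ℂ) : ℂ⸨X⸩) /
        ((1 + .X ^ 2 : PowerSeries ℂ) : ℂ⸨X⸩) ^ 2 := by
    have := Branch.s_ne_zero
    rw [PowerSeries.coe_sub, PowerSeries.coe_mul, PowerSeries.coe_pow]
    field_simp
  rw [h1, map_div₀, map_pow, Branch.val_coe_eq_one (g := 1 + .X ^ 2) (by simp), one_pow, div_one]
  exact Branch.val_coe_lt_one (by simp [Branch.sign])

end FigureEight

/-! ### Classification of the ideal points -/

namespace FigureEight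

open WithZero
open scoped LaurentSeries

instance : CharZero curve.FunctionField :=
  charZero_of_injective_algebraMap (algebraMap ℂ curve.FunctionField).injective

/-- A valuation of the function field that is trivial on the constants and centered at the point
`u = 0`, `v = ε` at infinity. -/
structure IsCenteredAt {Γ : Type} [LinearOrderedCommGroupWithZero Γ] (ε : ℂ)
    (W : Valuation curve.FunctionField Γ) : Prop where
  const : ∀ c : ℂ, W (algebraMap ℂ _ c) ≤ 1
  u_lt : W uFun < 1
  v_lt : W (vFun - algebraMap ℂ _ ε) < 1

/-- The ring of functions that are regular near infinity. -/
def ringAtInfinity : Subalgebra ℂ curve.FunctionField := Algebra.adjoin ℂ {uFun, vFun}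

theorem uFun_mem : uFun ∈ ringAtInfinity := Algebra.subset_adjoin (by simp)

theorem vFun_mem : vFun ∈ ringAtInfinity := Algebra.subset_adjoin (by simp)

namespace IsCenteredAt

variable {Γ : Type} [LinearOrderedCommGroupWithZero Γ] {ε : ℂ}
  {W : Valuation curve.FunctionField Γ}

theorem const_eq (hW : IsCenteredAt ε W) {c : ℂ} (hc : c ≠ 0) : W (algebraMap ℂ _ c) = 1 := by
  refine le_antisymm (hW.const c) ?_
  have h1 : W (algebraMap ℂ _ c) * W (algebraMap ℂ _ c⁻¹) = 1 := by
    rw [← map_mul, ← map_mul, mul_inv_cancel₀ hc, map_one, map_one]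
  by_contra h2
  exact absurd h1 (mul_lt_one_of_lt_of_le (not_le.mp h2) (hW.const _)).ne

theorem le_one_of_mem (hW : IsCenteredAt ε W) {g : curve.FunctionField}
    (hg : g ∈ ringAtInfinity) : W g ≤ 1 := by
  induction hg using Algebra.adjoin_induction with
  | mem g hg =>
    rcases hg with rfl | rfl
    · exact hW.u_lt.le
    · have := W.map_add (vFun - algebraMap ℂ _ ε) (algebraMap ℂ _ ε)
      rw [sub_add_cancel] at this
      exact this.trans (max_le hW.v_lt.le (hW.const ε))
  | algebraMap c => exact hW.const c
  | add g h _ _ hg hh => exact (W.map_add g h).trans (max_le hg hh)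
  | mul g h _ _ hg hh =>
    rw [map_mul]
    exact mul_le_one' hg hh

theorem v_add_eq (hW : IsCenteredAt ε W) (hε : ε ≠ 0) : W (vFun + algebraMap ℂ _ ε) = 1 := by
  have h : vFun + algebraMap ℂ curve.FunctionField ε =
      (vFun - algebraMap ℂ _ ε) + algebraMap ℂ _ (2 * ε) := by
    rw [map_mul, map_ofNat]
    ring
  have h2 := hW.const_eq (mul_ne_zero two_ne_zero hε)
  rw [h, Valuation.map_add_eq_of_lt_right, h2]
  rw [h2]
  exact hW.v_lt

end IsCenteredAt

namespace Branch

variable (r : Branch)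

theorem sign_ne_zero : r.sign ≠ 0 := by
  intro h
  have := r.sign_sq
  simp [h] at this

theorem isCenteredAt_val : IsCenteredAt r.sign r.val :=
  ⟨r.val_algebraMap_le, by
    rw [uFun, r.val_xFun_inv, ← exp_zero, exp_lt_exp]
    omega, r.val_vFun_sub⟩

/-- The function `v + ε` does not vanish at the point `u = 0`, `v = ε`, and `v - ε` is divisible
by `u` there. -/
theorem exists_sub_mul_eq {g : curve.FunctionField} (hg : g ∈ ringAtInfinity) :
    ∃ c : ℂ, ∃ h ∈ ringAtInfinity,
      (g - algebraMap ℂ _ c) * (vFun + algebraMap ℂ _ r.sign) = uFun * h := by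
  have hu := uFun_mem
  have hv := vFun_mem
  induction hg using Algebra.adjoin_induction with
  | mem g hg =>
    rcases hg with rfl | rfl
    · exact ⟨0, vFun + algebraMap ℂ _ r.sign, add_mem hv (algebraMap_mem _ _), by simp⟩
    · refine ⟨r.sign, algebraMap ℂ _ (-6) * uFun + algebraMap ℂ _ 5 * uFun ^ 3,
        add_mem (mul_mem (algebraMap_mem _ _) hu) (mul_mem (algebraMap_mem _ _) (pow_mem hu 3)), ?_⟩
      have h := congrArg (algebraMap ℂ curve.FunctionField) r.sign_sq
      rw [map_pow, map_one] at h
      rw [map_neg, map_ofNat, map_ofNat]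
      linear_combination vFun_sq - h
  | algebraMap c => exact ⟨c, 0, zero_mem _, by simp⟩
  | add g g' _ _ hg hg' =>
    obtain ⟨c, h, hh, e⟩ := hg
    obtain ⟨c', h', hh', e'⟩ := hg'
    refine ⟨c + c', h + h', add_mem hh hh', ?_⟩
    rw [map_add]
    linear_combination e + e'
  | mul g g' hg1 hg1' hg hg' =>
    obtain ⟨c, h, hh, e⟩ := hg
    obtain ⟨c', h', hh', e'⟩ := hg'
    refine ⟨c * c', h * g' + algebraMap ℂ _ c * h',
      add_mem (mul_mem hh hg1') (mul_mem (algebraMap_mem _ _) hh'), ?_⟩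
    rw [map_mul]
    linear_combination g' * e + algebraMap ℂ curve.FunctionField c * e'

/-- A rational function is a power of `u` times a function that is a unit for all valuations
centered at `u = 0`, `v = ε`. -/
def HasUniformFactorization (f : curve.FunctionField) : Prop :=
  ∃ (n : ℤ) (e : curve.FunctionField), f = uFun ^ n * e ∧
    ∀ (Γ : Type) [LinearOrderedCommGroupWithZero Γ] (W : Valuation curve.FunctionField Γ),
      IsCenteredAt r.sign W → W e = 1

variable {r}

theorem HasUniformFactorization.mul {f g : curve.FunctionField}
    (hf : r.HasUniformFactorization f) (hg : r.HasUniformFactorization g) :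
    r.HasUniformFactorization (f * g) := by
  obtain ⟨n, e, rfl, he⟩ := hf
  obtain ⟨m, d, rfl, hd⟩ := hg
  refine ⟨n + m, e * d, ?_, fun Γ _ W hW => ?_⟩
  · rw [zpow_add₀ uFun_ne_zero]
    ring
  · rw [map_mul, he Γ W hW, hd Γ W hW, one_mul]

theorem HasUniformFactorization.inv {f : curve.FunctionField}
    (hf : r.HasUniformFactorization f) : r.HasUniformFactorization f⁻¹ := by
  obtain ⟨n, e, rfl, he⟩ := hf
  refine ⟨-n, e⁻¹, ?_, fun Γ _ W hW => ?_⟩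
  · rw [mul_inv, zpow_neg]
  · rw [map_inv₀, he Γ W hW, inv_one]

theorem hasUniformFactorization_uFun_zpow (n : ℤ) : r.HasUniformFactorization (uFun ^ n) :=
  ⟨n, 1, by simp, fun Γ _ W _ => map_one W⟩

theorem hasUniformFactorization_of_forall {e : curve.FunctionField}
    (he : ∀ (Γ : Type) [LinearOrderedCommGroupWithZero Γ] (W : Valuation curve.FunctionField Γ),
      IsCenteredAt r.sign W → W e = 1) : r.HasUniformFactorization e :=
  ⟨0, e, by simp, he⟩

/-- Induction on the order of vanishing. At order 0 the value `c` at the center is nonzero, so `g`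
is a unit for every centered valuation; otherwise `c = 0` and `g` is `u / (v + ε)` times a function
of order one less. -/
theorem hasUniformFactorization_of_mem (n : ℕ) : ∀ {g : curve.FunctionField},
    g ∈ ringAtInfinity → r.val g = exp (-n : ℤ) → r.HasUniformFactorization g := by
  induction n with
  | zero =>
    intro g hg hn
    obtain ⟨c, h, hh, e⟩ := r.exists_sub_mul_eq hg
    have key : ∀ (Γ : Type) [LinearOrderedCommGroupWithZero Γ]
        (W : Valuation curve.FunctionField Γ), IsCenteredAt r.sign W →
        W (g - algebraMap ℂ _ c) < 1 := by
      intro Γ _ W hW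
      have h1 := congrArg W e
      rw [map_mul, map_mul, hW.v_add_eq r.sign_ne_zero, mul_one] at h1
      rw [h1]
      exact mul_lt_one_of_lt_of_le hW.u_lt (hW.le_one_of_mem hh)
    have hc : c ≠ 0 := by
      rintro rfl
      have := key _ r.val r.isCenteredAt_val
      rw [map_zero, sub_zero, hn] at this
      simp at this
    refine hasUniformFactorization_of_forall fun Γ _ W hW => ?_
    have h2 := key Γ W hW
    rw [← sub_add_cancel g (algebraMap ℂ _ c), Valuation.map_add_eq_of_lt_right, hW.const_eq hc]
    rwa [hW.const_eq hc]
  | succ n ih =>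
    intro g hg hn
    obtain ⟨c, h, hh, e⟩ := r.exists_sub_mul_eq hg
    have hr := r.isCenteredAt_val
    have hlt : r.val g < 1 := by
      rw [hn, ← exp_zero, exp_lt_exp]
      omega
    have hc : c = 0 := by
      by_contra hc
      have h1 : r.val (g - algebraMap ℂ _ c) = 1 := by
        rw [Valuation.map_sub_eq_of_lt_right, hr.const_eq hc]
        rwa [hr.const_eq hc]
      have h2 := congrArg r.val e
      rw [map_mul, map_mul, h1, hr.v_add_eq r.sign_ne_zero, mul_one] at h2
      exact (mul_lt_one_of_lt_of_le hr.u_lt (hr.le_one_of_mem hh)).ne h2.symm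
    rw [hc, map_zero, sub_zero] at e
    have hval : r.val h = exp (-n : ℤ) := by
      have h2 := congrArg r.val e
      rw [map_mul, map_mul, hn, hr.v_add_eq r.sign_ne_zero, mul_one, uFun, r.val_xFun_inv] at h2
      have h3 : r.val h = exp (1 : ℤ) * (exp (-1 : ℤ) * r.val h) := by
        rw [← mul_assoc, ← exp_add]
        simp
      rw [h3, ← h2, ← exp_add]
      congr 1
      push_cast
      ring
    have hv : vFun + algebraMap ℂ _ r.sign ≠ 0 := by
      intro h0
      have := hr.v_add_eq r.sign_ne_zero
      simp [h0] at this
    have hg' : g = uFun ^ (1 : ℤ) * h * (vFun + algebraMap ℂ _ r.sign)⁻¹ := by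
      rw [zpow_one, ← e, mul_assoc, mul_inv_cancel₀ hv, mul_one]
    rw [hg']
    exact ((hasUniformFactorization_uFun_zpow 1).mul (ih hh hval)).mul
      (hasUniformFactorization_of_forall fun Γ _ W hW => hW.v_add_eq r.sign_ne_zero).inv

theorem zFun_eq : zFun = (1 + uFun⁻¹ ^ 2 + uFun⁻¹ ^ 2 * vFun) / 2 := by
  have := xFun_ne_zero
  rw [vFun, uFun, inv_inv, wFun]
  field_simp
  ring

theorem exists_uFun_pow_mul_mem (a : curve.CoordinateRing) :
    ∃ n : ℕ, uFun ^ n * algebraMap curve.CoordinateRing curve.FunctionField a ∈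
      ringAtInfinity := by
  obtain ⟨P, rfl⟩ := Ideal.Quotient.mk_surjective a
  have hu := uFun_mem
  have hv := vFun_mem
  have hu0 := uFun_ne_zero
  -- One factor `u²` clears the poles of any coordinate.
  have hX : ∀ i : Fin 3, uFun ^ 2 * algebraMap curve.CoordinateRing curve.FunctionField
      (Ideal.Quotient.mk _ (X i)) ∈ ringAtInfinity := by
    have h0 : uFun ^ 2 * xFun ∈ ringAtInfinity := by
      have : uFun ^ 2 * xFun = uFun := by
        have := xFun_ne_zero
        rw [uFun]
        field_simp
      rwa [this]
    intro i
    fin_cases i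
    · exact h0
    · have : (Ideal.Quotient.mk curve.ideal (X 1) : curve.CoordinateRing) =
          Ideal.Quotient.mk curve.ideal (X 0) := by
        rw [Ideal.Quotient.eq, mem_vanishingIdeal_iff]
        intro v hv
        simp [(mem_canonicalSet_iff.mp hv).1]
      change uFun ^ 2 * algebraMap curve.CoordinateRing curve.FunctionField
        (Ideal.Quotient.mk curve.ideal (X 1)) ∈ _
      rw [this]
      exact h0
    · change uFun ^ 2 * zFun ∈ _
      have : uFun ^ 2 * zFun = algebraMap ℂ _ (1 / 2) * (uFun ^ 2 + 1 + vFun) := by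
        rw [zFun_eq, map_div₀, map_one, map_ofNat]
        field_simp
      rw [this]
      exact mul_mem (algebraMap_mem _ _) (add_mem (add_mem (pow_mem hu 2) (one_mem _)) hv)
  induction P using MvPolynomial.induction_on with
  | C c =>
    refine ⟨0, ?_⟩
    rw [pow_zero, one_mul]
    exact algebraMap_mem ringAtInfinity c
  | add P Q hP hQ =>
    obtain ⟨n, hn⟩ := hP
    obtain ⟨m, hm⟩ := hQ
    refine ⟨n + m, ?_⟩
    have := add_mem (mul_mem (pow_mem hu m) hn) (mul_mem (pow_mem hu n) hm)
    convert this using 1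
    rw [map_add, map_add]
    ring
  | mul_X P i hP =>
    obtain ⟨n, hn⟩ := hP
    refine ⟨n + 2, ?_⟩
    have := mul_mem hn (hX i)
    convert this using 1
    rw [map_mul, map_mul]
    ring

theorem hasUniformFactorization_algebraMap {a : curve.CoordinateRing} (ha : a ≠ 0) :
    r.HasUniformFactorization (algebraMap curve.CoordinateRing curve.FunctionField a) := by
  obtain ⟨n, hn⟩ := exists_uFun_pow_mul_mem a
  have h0 : algebraMap curve.CoordinateRing curve.FunctionField a ≠ 0 := by
    simpa using ha
  have h1 := r.isCenteredAt_val.le_one_of_mem hn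
  have h2 : r.val (uFun ^ n * algebraMap curve.CoordinateRing curve.FunctionField a) ≠ 0 := by
    rw [Valuation.ne_zero_iff]
    exact mul_ne_zero (pow_ne_zero n uFun_ne_zero) h0
  rw [← exp_log h2, ← exp_zero, exp_le_exp] at h1
  obtain ⟨m, hm⟩ := Int.eq_ofNat_of_zero_le (neg_nonneg.mpr h1)
  have h3 := hasUniformFactorization_of_mem (r := r) m hn (by
    rw [← exp_log h2]
    congr 1
    omega)
  have h4 : algebraMap curve.CoordinateRing curve.FunctionField a =
      uFun ^ (-n : ℤ) * (uFun ^ n * algebraMap curve.CoordinateRing curve.FunctionField a) := by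
    have := uFun_ne_zero
    rw [zpow_neg, zpow_natCast, ← mul_assoc, inv_mul_cancel₀ (pow_ne_zero n this), one_mul]
  rw [h4]
  exact (hasUniformFactorization_uFun_zpow _).mul h3

theorem hasUniformFactorization {f : curve.FunctionField} (hf : f ≠ 0) :
    r.HasUniformFactorization f := by
  obtain ⟨a, b, hb, rfl⟩ := IsFractionRing.div_surjective (A := curve.CoordinateRing) f
  have ha : a ≠ 0 := by
    rintro rfl
    simp at hf
  rw [div_eq_mul_inv]
  exact (hasUniformFactorization_algebraMap ha).mul
    (hasUniformFactorization_algebraMap (nonZeroDivisors.ne_zero hb)).inv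

theorem uFun_zpow_le_one_iff {Γ : Type} [LinearOrderedCommGroupWithZero Γ]
    {W : Valuation curve.FunctionField Γ} (hW : W uFun < 1) (n : ℤ) :
    W (uFun ^ n) ≤ 1 ↔ 0 ≤ n := by
  have h0 : 0 < W uFun := by
    rw [zero_lt_iff, Valuation.ne_zero_iff]
    exact uFun_ne_zero
  rw [map_zpow₀]
  constructor
  · intro h
    by_contra hn
    have : 1 < W uFun ^ n := one_lt_zpow_of_neg₀ h0 hW (not_le.mp hn)
    exact absurd h (not_le.mpr this)
  · intro h
    exact zpow_le_one₀ h0 hW.le h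

/-- For `f = uⁿ e` with `e` a unit for both valuations, membership in either ring means `n ≥ 0`. -/
theorem place_eq_of_isCenteredAt (P : Place curve.FunctionField)
    (hP : IsCenteredAt r.sign P.ring.valuation) : P = r.place := by
  apply Place.ext_ring
  ext f
  rw [mem_place_ring_iff, ← ValuationSubring.valuation_le_one_iff]
  rcases eq_or_ne f 0 with rfl | hf
  · simp
  obtain ⟨n, e, rfl, he⟩ := hasUniformFactorization (r := r) hf
  rw [map_mul, map_mul, he _ _ hP, he _ _ r.isCenteredAt_val, mul_one, mul_one,
    uFun_zpow_le_one_iff hP.u_lt, uFun_zpow_le_one_iff r.isCenteredAt_val.u_lt]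

variable (r)

theorem place_eq_or_eq (P : Place curve.FunctionField) (hP : xFun ∉ P.ring) :
    P = r.place ∨ P = (-r).place := by
  set W := P.ring.valuation with hW
  have hc : ∀ c : ℂ, W (algebraMap ℂ _ c) ≤ 1 := fun c =>
    (P.ring.valuation_le_one_iff _).mpr (P.const_mem c)
  have hu : W uFun < 1 := by
    rw [← ValuationSubring.valuation_le_one_iff, not_le] at hP
    rw [uFun, map_inv₀]
    exact inv_lt_one_of_one_lt₀ hP
  -- The product is divisible by `u`, so one factor has value less than 1 and the place is centered
  -- at one of the two points.
  have key : (vFun - algebraMap ℂ _ r.sign) * (vFun - algebraMap ℂ _ (-r).sign) =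
      uFun * (uFun * (algebraMap ℂ _ (-6) + algebraMap ℂ _ 5 * uFun ^ 2)) := by
    have h := congrArg (algebraMap ℂ curve.FunctionField) r.sign_sq
    rw [map_pow, map_one] at h
    rw [sign_neg, map_neg, map_neg, map_ofNat, map_ofNat]
    linear_combination vFun_sq - h
  have hle : W (uFun * (algebraMap ℂ _ (-6) + algebraMap ℂ _ 5 * uFun ^ 2)) ≤ 1 := by
    rw [map_mul]
    refine mul_le_one' hu.le ((W.map_add _ _).trans (max_le (hc _) ?_))
    rw [map_mul, map_pow]
    exact mul_le_one' (hc _) (pow_le_one' hu.le 2)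
  have hlt : W (vFun - algebraMap ℂ _ r.sign) * W (vFun - algebraMap ℂ _ (-r).sign) < 1 := by
    rw [← map_mul, key, map_mul]
    exact mul_lt_one_of_lt_of_le hu hle
  by_cases h : W (vFun - algebraMap ℂ _ r.sign) < 1
  · exact Or.inl (place_eq_of_isCenteredAt P ⟨hc, hu, h⟩)
  · by_cases h' : W (vFun - algebraMap ℂ _ (-r).sign) < 1
    · exact Or.inr (place_eq_of_isCenteredAt P ⟨hc, hu, h'⟩)
    · exact absurd hlt (not_lt.mpr (one_le_mul (not_lt.mp h) (not_lt.mp h')))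

theorem xFun_notMem_place : xFun ∉ r.place.ring := by
  rw [mem_place_ring_iff, r.val_xFun, ← exp_zero, exp_le_exp]
  omega

/-- The function `v + ε` is a unit at the first place and vanishes at the second. -/
theorem place_ne_place_neg : r.place ≠ (-r).place := by
  intro h
  have h1 : (vFun + algebraMap ℂ _ r.sign)⁻¹ ∈ r.place.ring := by
    rw [mem_place_ring_iff, map_inv₀, r.isCenteredAt_val.v_add_eq r.sign_ne_zero, inv_one]
  have h0 : vFun + algebraMap ℂ _ r.sign ≠ 0 := by
    intro h0
    have := r.isCenteredAt_val.v_add_eq r.sign_ne_zero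
    simp [h0] at this
  rw [h, mem_place_ring_iff] at h1
  have h2 := (-r).isCenteredAt_val.v_lt
  rw [sign_neg, map_neg, sub_neg_eq_add] at h2
  have := mul_lt_one_of_lt_of_le h2 h1
  rw [← map_mul, mul_inv_cancel₀ h0, map_one] at this
  exact lt_irrefl _ this

end Branch

/-- If `x` is regular, so is `w`, whose square is a polynomial in `x`; then `z` and all regular
functions are regular. -/
theorem xFun_notMem_of_isIdealPoint {P : Place curve.FunctionField}
    (hP : curve.IsIdealPoint P) : xFun ∉ P.ring := by
  intro hx
  have hconst : ∀ c : ℂ, algebraMap ℂ _ c ∈ P.ring := P.const_mem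
  have hw : wFun ∈ P.ring := by
    rw [← ValuationSubring.valuation_le_one_iff]
    have h2 : P.ring.valuation (wFun ^ 2) ≤ 1 := by
      rw [ValuationSubring.valuation_le_one_iff, wFun_sq]
      have h6 := hconst 6
      have h5 := hconst 5
      rw [map_ofNat] at h6 h5
      exact add_mem (sub_mem (pow_mem hx 4) (mul_mem h6 (pow_mem hx 2))) h5
    rw [map_pow] at h2
    by_contra h
    exact absurd h2 (not_le.mpr (one_lt_pow₀ (not_le.mp h) two_ne_zero))
  have hz : zFun ∈ P.ring := by
    have : zFun = algebraMap ℂ _ (1 / 2) * (1 + xFun ^ 2 + wFun) := by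
      rw [wFun, map_div₀, map_one, map_ofNat]
      ring
    rw [this]
    exact mul_mem (hconst _) (add_mem (add_mem (one_mem _) (pow_mem hx 2)) hw)
  obtain ⟨a, ha⟩ := hP
  apply ha
  obtain ⟨Q, rfl⟩ := Ideal.Quotient.mk_surjective a
  clear ha
  induction Q using MvPolynomial.induction_on with
  | C c => exact hconst c
  | add Q R hQ hR =>
    rw [map_add, map_add]
    exact add_mem hQ hR
  | mul_X Q i hQ =>
    rw [map_mul, map_mul]
    refine mul_mem hQ ?_
    fin_cases i
    · exact hx
    · have : (Ideal.Quotient.mk curve.ideal (X 1) : curve.CoordinateRing) =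
          Ideal.Quotient.mk curve.ideal (X 0) := by
        rw [Ideal.Quotient.eq, mem_vanishingIdeal_iff]
        intro v hv
        simp [(mem_canonicalSet_iff.mp hv).1]
      change algebraMap curve.CoordinateRing curve.FunctionField
        (Ideal.Quotient.mk curve.ideal (X 1)) ∈ _
      rw [this]
      exact hx
    · exact hz

theorem setOf_isIdealPoint (r : Branch) :
    {P | curve.IsIdealPoint P} = {r.place, (-r).place} := by
  ext P
  constructor
  · intro hP
    exact r.place_eq_or_eq P (xFun_notMem_of_isIdealPoint hP)
  · rintro (rfl | rfl)
    · exact ⟨_, r.xFun_notMem_place⟩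
    · exact ⟨_, (-r).xFun_notMem_place⟩

end FigureEight

namespace FigureEight

open WithZero
open scoped LaurentSeries

/-! ### Trace functions and their recurrences -/

section TraceFunctions

/-- Every point of the curve is a character, so identities of regular functions may be checked on
representations. -/
theorem coordinateRing_mk_eq {F G : MvPolynomial (Fin 3) ℂ}
    (h : ∀ ρ : KnotGroup →* SL2, character ρ ∈ canonicalSet →
      eval (character ρ) F = eval (character ρ) G) :
    (Ideal.Quotient.mk curve.ideal F : curve.CoordinateRing) = Ideal.Quotient.mk curve.ideal G := by
  rw [Ideal.Quotient.eq, mem_vanishingIdeal_iff]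
  intro v hv
  obtain ⟨ρ, rfl⟩ := exists_character_eq hv
  have := h ρ hv
  rw [map_sub, sub_eq_zero]
  exact this

theorem eval_tracePolynomial (g : KnotGroup) (ρ : KnotGroup →* SL2) :
    eval (character ρ) (exists_tracePolynomial g).choose = (ρ g).1.trace :=
  (exists_tracePolynomial g).choose_spec ρ

theorem traceFunction_eq_mk {g : KnotGroup} {F : MvPolynomial (Fin 3) ℂ}
    (h : ∀ ρ : KnotGroup →* SL2, character ρ ∈ canonicalSet →
      (ρ g).1.trace = eval (character ρ) F) :
    traceFunction curve g = Ideal.Quotient.mk curve.ideal F :=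
  coordinateRing_mk_eq fun ρ hρ => by rw [eval_tracePolynomial, h ρ hρ]

theorem trace_mul_add_trace_mul_inv {R : Type*} [CommRing R]
    (A B : Matrix.SpecialLinearGroup (Fin 2) R) :
    (A * B).1.trace + (A * B⁻¹).1.trace = A.1.trace * B.1.trace := by
  rw [Matrix.SpecialLinearGroup.coe_mul, Matrix.SpecialLinearGroup.coe_mul, coe_inv_eq, mul_sub,
    Matrix.mul_smul, mul_one, Matrix.trace_sub, Matrix.trace_smul, smul_eq_mul]
  ring

theorem traceFunction_mul_add_mul_inv (g h : KnotGroup) :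
    traceFunction curve (g * h) + traceFunction curve (g * h⁻¹) =
      traceFunction curve g * traceFunction curve h := by
  simp only [traceFunction]
  rw [← map_add, ← map_mul]
  refine coordinateRing_mk_eq fun ρ _ => ?_
  rw [RingHom.map_add, RingHom.map_mul, eval_tracePolynomial, eval_tracePolynomial,
    eval_tracePolynomial, eval_tracePolynomial, ← trace_mul_add_trace_mul_inv, map_mul, map_mul,
    map_inv]

/-- This form serves the recurrence in `p`, where the power of `α` stands on the left. -/
theorem traceFunction_mul_add_inv_mul (g h : KnotGroup) :
    traceFunction curve (g * h) + traceFunction curve (g⁻¹ * h) =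
      traceFunction curve g * traceFunction curve h := by
  have hcomm : ∀ a b : KnotGroup, traceFunction curve (a * b) = traceFunction curve (b * a) := by
    intro a b
    refine coordinateRing_mk_eq fun ρ _ => ?_
    simp only [eval_tracePolynomial]
    rw [map_mul, map_mul, Matrix.SpecialLinearGroup.coe_mul, Matrix.trace_mul_comm,
      ← Matrix.SpecialLinearGroup.coe_mul]
  rw [hcomm g h, hcomm g⁻¹ h, traceFunction_mul_add_mul_inv, mul_comm]

end TraceFunctions

theorem eq_of_linear_recurrence {F : Type*} [Field F] {a : ℤ → F} {t c d : F} (ht : t ≠ 0)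
    (h : ∀ n, a (n + 1) + a (n - 1) = (t + t⁻¹) * a n) (h0 : a 0 = c + d)
    (h1 : a 1 = c * t + d * t⁻¹) (n : ℤ) : a n = c * t ^ n + d * t⁻¹ ^ n := by
  have key : ∀ n : ℤ, (t + t⁻¹) * (c * t ^ n + d * t⁻¹ ^ n) =
      (c * t ^ (n + 1) + d * t⁻¹ ^ (n + 1)) + (c * t ^ (n - 1) + d * t⁻¹ ^ (n - 1)) := by
    intro n
    rw [zpow_add_one₀ ht, zpow_add_one₀ (inv_ne_zero ht), zpow_sub_one₀ ht,
      zpow_sub_one₀ (inv_ne_zero ht), inv_inv]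
    ring
  suffices h2 : ∀ n : ℤ, a n = c * t ^ n + d * t⁻¹ ^ n ∧
      a (n + 1) = c * t ^ (n + 1) + d * t⁻¹ ^ (n + 1) from (h2 n).1
  intro n
  induction n with
  | zero => simpa using ⟨h0, h1⟩
  | succ i ih =>
    refine ⟨ih.2, ?_⟩
    have e := h (i + 1)
    rw [ih.2, key (i + 1), add_sub_cancel_right, ih.1] at e
    exact add_right_cancel e
  | pred i ih =>
    have e := h (-i)
    rw [ih.1, key, ih.2] at e
    refine ⟨add_left_cancel e, ?_⟩
    rw [sub_add_cancel]
    exact ih.1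

/-! ### Eigenvalues of peripheral elements and pole orders -/

namespace Branch

variable (r : Branch)

/-- The Laurent expansion of the eigenvalue of the longitude that belongs to the eigenvalue
`s⁻¹` of the meridian. -/
def ell : ℂ⸨X⸩ := (x ^ 4 - 5 * x ^ 2 + 2 - (s⁻¹ ^ 2 - s ^ 2) * r.w) / 2

theorem w_neg : (-r).w = -r.w := by
  change s⁻¹ ^ 2 * ((-r.1 : PowerSeries ℂ) : ℂ⸨X⸩) = _
  rw [PowerSeries.coe_neg, w]
  ring

theorem ell_mul_ell_neg : r.ell * (-r).ell = 1 := by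
  have hs := s_ne_zero
  have hw := r.w_sq
  rw [ell, ell, w_neg]
  -- Here `(s⁻² - s²)² = x² (x² - 4)`, so this says `I_λ² - 4 = x² (x² - 4) w²`: the two eigenvalues
  -- are exchanged by `w ↦ -w`.
  have h : (x ^ 4 - 5 * x ^ 2 + 2) ^ 2 - (s⁻¹ ^ 2 - s ^ 2) ^ 2 * (x ^ 4 - 6 * x ^ 2 + 5) = 4 := by
    rw [x]
    field_simp
    ring
  linear_combination (1 / 4 : ℂ⸨X⸩) * h - (s⁻¹ ^ 2 - s ^ 2) ^ 2 / 4 * hw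

theorem ell_ne_zero : r.ell ≠ 0 := left_ne_zero_of_mul_eq_one r.ell_mul_ell_neg

theorem ell_inv : r.ell⁻¹ = (-r).ell := inv_eq_of_mul_eq_one_right r.ell_mul_ell_neg

theorem ell_add_inv : r.ell + r.ell⁻¹ = x ^ 4 - 5 * x ^ 2 + 2 := by
  rw [ell_inv, ell, ell, w_neg]
  ring

theorem expand_traceFunction_one : r.expand (traceFunction curve 1) = 2 := by
  rw [traceFunction_eq_mk (F := C 2) (fun ρ _ => by simp), expand_mk]
  simp [map_ofNat]

theorem expand_traceFunction_α : r.expand (traceFunction curve α) = s⁻¹ + s := by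
  rw [traceFunction_eq_mk (F := X 0) (fun ρ _ => by simp [character]), expand_mk]
  simp [x]

theorem expand_traceFunction_longitude :
    r.expand (traceFunction curve longitude) = r.ell + r.ell⁻¹ := by
  rw [traceFunction_eq_mk (F := X 0 ^ 4 - 5 * X 0 ^ 2 + 2)
    (fun ρ hρ => by simp [trace_longitude_eq ρ hρ, map_ofNat]), expand_mk, ell_add_inv]
  simp [map_ofNat]

theorem expand_traceFunction_α_mul_longitude :
    r.expand (traceFunction curve (α * longitude)) = s⁻¹ * r.ell + s * r.ell⁻¹ := by
  rw [traceFunction_eq_mk (F := X 2 * (4 * X 0 - X 0 ^ 3) + X 0 ^ 5 - 4 * X 0 ^ 3 - X 0)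
    (fun ρ hρ => by rw [trace_mul_longitude_eq ρ hρ]; simp [map_ofNat]), expand_mk, ell_inv, ell, ell,
    w_neg]
  simp [map_ofNat, z]
  have hs := s_ne_zero
  rw [x]
  field_simp
  ring

theorem expand_traceFunction_longitude_zpow (q : ℤ) :
    r.expand (traceFunction curve (longitude ^ q)) = r.ell ^ q + r.ell⁻¹ ^ q := by
  refine (eq_of_linear_recurrence
    (a := fun q : ℤ => r.expand (traceFunction curve (longitude ^ q)))
    (c := 1) (d := 1) r.ell_ne_zero (fun n => ?_) ?_ ?_ q).trans ?_
  · rw [zpow_add_one, zpow_sub_one, ← map_add, traceFunction_mul_add_mul_inv, map_mul,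
      expand_traceFunction_longitude, mul_comm]
  · rw [zpow_zero, expand_traceFunction_one, one_add_one_eq_two]
  · rw [zpow_one, expand_traceFunction_longitude, one_mul, one_mul]
  · rw [one_mul, one_mul]

theorem expand_traceFunction_α_mul_longitude_zpow (q : ℤ) :
    r.expand (traceFunction curve (α * longitude ^ q)) =
      s⁻¹ * r.ell ^ q + s * r.ell⁻¹ ^ q := by
  refine eq_of_linear_recurrence
    (a := fun q : ℤ => r.expand (traceFunction curve (α * longitude ^ q)))
    r.ell_ne_zero (fun n => ?_) ?_ ?_ q
  · rw [zpow_add_one, zpow_sub_one, ← mul_assoc, ← mul_assoc, ← map_add,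
      traceFunction_mul_add_mul_inv, map_mul, expand_traceFunction_longitude, mul_comm]
  · rw [zpow_zero, mul_one, expand_traceFunction_α]
  · rw [zpow_one, expand_traceFunction_α_mul_longitude]

/-- The Laurent expansion of the eigenvalue of the peripheral element `p α + q λ`. -/
def eigenvalue (p q : ℤ) : ℂ⸨X⸩ := s⁻¹ ^ p * r.ell ^ q

theorem expand_traceFunction_peripheral (p q : ℤ) :
    r.expand (traceFunction curve (peripheral p q)) =
      r.eigenvalue p q + (r.eigenvalue p q)⁻¹ := by
  refine (eq_of_linear_recurrence
    (a := fun p : ℤ => r.expand (traceFunction curve (α ^ p * longitude ^ q)))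
    (t := s⁻¹) (c := r.ell ^ q) (d := r.ell⁻¹ ^ q) (inv_ne_zero s_ne_zero) (fun n => ?_) ?_ ?_
    p).trans ?_
  · rw [zpow_add_one, zpow_sub_one, (Commute.self_zpow α n).eq.symm,
      (Commute.zpow_self α n).inv_right.eq, mul_assoc, mul_assoc, ← map_add,
      traceFunction_mul_add_inv_mul, map_mul, expand_traceFunction_α, inv_inv]
  · rw [zpow_zero, one_mul, r.expand_traceFunction_longitude_zpow q]
  · rw [zpow_one, expand_traceFunction_α_mul_longitude_zpow, inv_inv]
    ring
  · rw [eigenvalue, mul_inv, ← inv_zpow s⁻¹ p, ← inv_zpow r.ell q, mul_comm (r.ell ^ q),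
      mul_comm (r.ell⁻¹ ^ q)]

theorem laurent_f (p q : ℤ) : r.laurent (f curve (peripheral p q)) =
    (r.eigenvalue p q - (r.eigenvalue p q)⁻¹) ^ 2 := by
  have h0 : r.eigenvalue p q ≠ 0 :=
    mul_ne_zero (zpow_ne_zero _ (inv_ne_zero s_ne_zero)) (zpow_ne_zero _ r.ell_ne_zero)
  rw [f, laurent_algebraMap, map_sub, map_pow, expand_traceFunction_peripheral, map_ofNat]
  field_simp
  ring

/-- After extracting `s⁻⁴` the constant term is `(1 - ε) / 2`, which is 1 for `ε = -1`. On the other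
branch the leading terms cancel, and `ell_inv` gives the order instead. -/
theorem val_ell (h : r.sign = -1) : Valued.v r.ell = exp (4 : ℤ) := by
  have e : r.ell = s⁻¹ ^ 4 * (((PowerSeries.C (1 / 2) * (1 - .X ^ 2 - 2 * .X ^ 4 - .X ^ 6 + .X ^ 8 -
      (1 - .X ^ 4) * r.1) : PowerSeries ℂ)) : ℂ⸨X⸩) := by
    have hs := s_ne_zero
    rw [ell, x, w]
    simp only [map_pow, map_sub, map_add, map_mul, map_one, map_ofNat]
    rw [← s, PowerSeries.coe_C, ← LaurentSeries.algebraMap_apply, map_div₀, map_one, map_ofNat]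
    field_simp
    ring
  rw [e, map_mul, map_pow, map_inv₀, val_s, val_coe_eq_one, mul_one, ← exp_neg, ← exp_nsmul]
  · simp
  · have : PowerSeries.constantCoeff (R := ℂ) r.1 = -1 := h
    simp [this]

theorem val_eigenvalue (p q : ℤ) {m : ℤ} (h : Valued.v r.ell = exp m) :
    Valued.v (r.eigenvalue p q) = exp (p + m * q) := by
  rw [eigenvalue, map_mul, map_zpow₀, map_zpow₀, map_inv₀, val_s, h, ← exp_neg, ← exp_zsmul,
    ← exp_zsmul, ← exp_add]
  congr 1
  simp
  ring

end Branch

theorem val_sub_inv_sq {F : Type*} [Field F] (v : Valuation F ℤᵐ⁰) {a : F} {n : ℤ}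
    (h : v a = exp n) (hn : n ≠ 0) : v ((a - a⁻¹) ^ 2) = exp (2 * |n|) := by
  have hi : v a⁻¹ = exp (-n) := by rw [map_inv₀, h, exp_neg]
  rw [map_pow]
  have : v (a - a⁻¹) = exp |n| := by
    rcases lt_or_gt_of_ne hn with h0 | h0
    · rw [Valuation.map_sub_eq_of_lt_right, hi, abs_of_neg h0]
      rw [h, hi, exp_lt_exp]
      omega
    · rw [Valuation.map_sub_eq_of_lt_left, h, abs_of_pos h0]
      rw [h, hi, exp_lt_exp]
      omega
  rw [this, ← exp_nsmul, nsmul_eq_mul]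
  rfl

theorem val_sub_inv_sq_le_one {F : Type*} [Field F] (v : Valuation F ℤᵐ⁰) {a : F}
    (h : v a = 1) : v ((a - a⁻¹) ^ 2) ≤ 1 := by
  rw [map_pow]
  refine pow_le_one' ((v.map_sub _ _).trans (max_le h.le ?_)) 2
  rw [map_inv₀, h, inv_one]

namespace Branch

variable (r : Branch)

theorem poleOrder_f (p q : ℤ) {m : ℤ} (h : Valued.v r.ell = exp m) :
    (r.place.poleOrder (f curve (peripheral p q)) : ℤ) = 2 * |p + m * q| := by
  have h1 := r.val_eigenvalue p q h
  -- When the eigenvalue is a unit, `E` and `E⁻¹` may cancel, but regularity of `f` is all that is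
  -- needed.
  rcases eq_or_ne (p + m * q) 0 with h0 | h0
  · rw [h0, exp_zero] at h1
    rw [Place.poleOrder_eq_zero, h0]
    · simp
    · rw [mem_place_ring_iff, val_apply, laurent_f]
      exact val_sub_inv_sq_le_one _ h1
  · have h2 := val_sub_inv_sq _ h1 h0
    have h3 : ((2 * (p + m * q).natAbs : ℕ) : ℤ) = 2 * |p + m * q| := by
      push_cast
      rfl
    rw [← laurent_f, ← val_apply, ← h3] at h2
    rw [← h3]
    exact congrArg Nat.cast (Place.poleOrder_ofValuation _ _ _ _ h2)

end Branch

/-! ### The norm and its uniqueness -/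

section Norm

/-- The norm `2 (|s + 4 t| + |s - 4 t|)`. -/
def cullerShalenNorm : Seminorm ℝ (ℝ × ℝ) :=
  Seminorm.of (fun v => 2 * (|v.1 + 4 * v.2| + |v.1 - 4 * v.2|))
    (fun v w => by
      have h1 := abs_add_le (v.1 + 4 * v.2) (w.1 + 4 * w.2)
      have h2 := abs_add_le (v.1 - 4 * v.2) (w.1 - 4 * w.2)
      have e1 : (v + w).1 + 4 * (v + w).2 = v.1 + 4 * v.2 + (w.1 + 4 * w.2) := by
        simp
        ring
      have e2 : (v + w).1 - 4 * (v + w).2 = v.1 - 4 * v.2 + (w.1 - 4 * w.2) := by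
        simp
        ring
      rw [e1, e2]
      linarith)
    (fun c v => by
      have e1 : (c • v).1 + 4 * (c • v).2 = c * (v.1 + 4 * v.2) := by
        simp
        ring
      have e2 : (c • v).1 - 4 * (c • v).2 = c * (v.1 - 4 * v.2) := by
        simp
        ring
      rw [e1, e2, abs_mul, abs_mul, Real.norm_eq_abs]
      ring)

theorem cullerShalenNorm_apply (v : ℝ × ℝ) :
    cullerShalenNorm v = 2 * (|v.1 + 4 * v.2| + |v.1 - 4 * v.2|) := rfl

theorem eq_zero_of_cullerShalenNorm_eq_zero (v : ℝ × ℝ) (h : cullerShalenNorm v = 0) : v = 0 := by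
  rw [cullerShalenNorm_apply] at h
  have h1 := abs_nonneg (v.1 + 4 * v.2)
  have h2 := abs_nonneg (v.1 - 4 * v.2)
  have h3 : v.1 + 4 * v.2 = 0 := abs_eq_zero.mp (by linarith)
  have h4 : v.1 - 4 * v.2 = 0 := abs_eq_zero.mp (by linarith)
  exact Prod.ext (by simp; linarith) (by simp; linarith)

theorem continuous_seminorm_prod (N : Seminorm ℝ (ℝ × ℝ)) : Continuous N := by
  rw [← continuousOn_univ]
  exact ConvexOn.continuousOn isOpen_univ N.convexOn

/-- Homogeneity passes from integral to rational points, and continuity from there to the plane. -/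
theorem seminorm_eq_of_forall_int {N N' : Seminorm ℝ (ℝ × ℝ)}
    (h : ∀ p q : ℤ, N ((p : ℝ), (q : ℝ)) = N' ((p : ℝ), (q : ℝ))) : N = N' := by
  have hd : DenseRange (Prod.map ((↑) : ℚ → ℝ) ((↑) : ℚ → ℝ)) :=
    Rat.denseRange_cast.prodMap Rat.denseRange_cast
  refine DFunLike.coe_injective (hd.equalizer (continuous_seminorm_prod N)
    (continuous_seminorm_prod N') (funext fun v => ?_))
  obtain ⟨a, b⟩ := v
  have ha : (a.den : ℝ) ≠ 0 := by exact_mod_cast a.den_nz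
  have hb : (b.den : ℝ) ≠ 0 := by exact_mod_cast b.den_nz
  have e : ((a : ℝ), (b : ℝ)) = ((a.den : ℝ) * b.den)⁻¹ •
      (((a.num * b.den : ℤ) : ℝ), ((b.num * a.den : ℤ) : ℝ)) := by
    rw [Prod.smul_mk, smul_eq_mul, smul_eq_mul, Rat.cast_def a, Rat.cast_def b]
    push_cast
    ext
    · field_simp
    · field_simp
  simp only [Function.comp, Prod.map_apply]
  rw [e, map_smul_eq_mul, map_smul_eq_mul, h]

end Norm

/-! ### Degrees, components and the faithful characters -/

theorem meromorphicDegree_f (r : Branch) (g : KnotGroup) : meromorphicDegree (f curve g) =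
    r.place.poleOrder (f curve g) + (-r).place.poleOrder (f curve g) := by
  classical
  rw [meromorphicDegree, finsum_eq_finsetSum_of_support_subset (s := {r.place, (-r).place}),
    Finset.sum_pair r.place_ne_place_neg]
  intro P hP
  rw [Finset.coe_pair, ← setOf_isIdealPoint r]
  -- As `f_g` is a regular function, a pole of it witnesses that `P` is an ideal point.
  refine ⟨_, fun h => hP (Place.poleOrder_eq_zero h)⟩

theorem mem_canonicalSet_or_character_two_eq (ρ : KnotGroup →* SL2) :
    character ρ ∈ canonicalSet ∨ character ρ 2 = character ρ 0 ^ 2 - 2 := by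
  by_cases h : ρ α = ρ β
  · exact Or.inr (character_two_of_eq ρ h)
  · exact Or.inl (mem_canonicalSet_of_ne ρ h)

/-- An irreducible subvariety of the character variety consists of reducible characters only, or
it is contained in the curve. -/
theorem subset_canonicalSet {Y : AffineVariety 3} (hY : Y.carrier ⊆ characterVariety)
    {v : Fin 3 → ℂ} (hv : v ∈ Y.carrier) (hv2 : v 2 ≠ v 0 ^ 2 - 2) :
    Y.carrier ⊆ canonicalSet := by
  have h1 : rileyPolynomial (X 0) (X 2) * (X 2 - X 0 ^ 2 + 2) ∈ Y.ideal := by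
    rw [mem_vanishingIdeal_iff]
    intro w hw
    obtain ⟨ρ, rfl⟩ := hY hw
    rcases mem_canonicalSet_or_character_two_eq ρ with h | h
    · have h0 : aeval (character ρ) (rileyPolynomial (X 0) (X 2) : MvPolynomial (Fin 3) ℂ) = 0 := by
        simpa [rileyPolynomial] using (mem_canonicalSet_iff.mp h).2
      rw [map_mul, h0, zero_mul]
    · simp [h, map_ofNat]
  rcases Y.prime.mem_or_mem h1 with h | h
  · intro w hw
    obtain ⟨ρ, rfl⟩ := hY hw
    refine mem_canonicalSet_iff.mpr ⟨(character_one ρ).symm, ?_⟩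
    have := mem_vanishingIdeal_iff.mp h _ hw
    simpa [rileyPolynomial] using this
  · have := mem_vanishingIdeal_iff.mp h v hv
    simp [map_ofNat] at this
    exact absurd (by linear_combination this) hv2

theorem canonicalSet_subset : canonicalSet ⊆ characterVariety := fun _ hv =>
  exists_character_eq hv

theorem curve_isComponentOf : curve.IsComponentOf characterVariety := by
  refine ⟨canonicalSet_subset, fun Y hY hY' => ?_⟩
  -- A point of the curve with `x = 0` is off `z = x² - 2`, since the Riley polynomial is 5 at `(0,
  -- -2)`.
  obtain ⟨z, hz⟩ := exists_rileyPolynomial_eq_zero 0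
  refine Set.Subset.antisymm
    (subset_canonicalSet hY' (v := ![0, 0, z]) (hY ⟨rfl, hz⟩) fun h => ?_) hY
  have h : z = 0 ^ 2 - 2 := h
  rw [h, rileyPolynomial] at hz
  norm_num at hz

/-- Faithfulness keeps the character off `z = x² - 2`, so a component through it is contained in the
curve and equals it by maximality. -/
theorem eq_curve_of_isDiscreteFaithful {ρ : KnotGroup →* SL2} (hρ : IsDiscreteFaithful ρ) :
    character ρ ∈ curve.carrier ∧ ∀ Y : AffineVariety 3, Y.IsComponentOf characterVariety →
      character ρ ∈ Y.carrier → Y.carrier = curve.carrier := by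
  refine ⟨mem_canonicalSet_of_ne ρ fun h => α_ne_β (hρ.1 h), fun Y hY hv => ?_⟩
  exact (hY.2 curve (subset_canonicalSet hY.1 hv (character_two_ne_of_injective ρ hρ.1))
    canonicalSet_subset).symm

theorem exists_branch_sign_eq_neg_one : ∃ r : Branch, r.sign = -1 := by
  obtain ⟨r, hr⟩ := exists_branch
  exact ⟨-r, by rw [Branch.sign_neg, Branch.sign, hr]⟩

theorem poleOrder_f_place {r : Branch} (hr : r.sign = -1) (p q : ℤ) :
    (r.place.poleOrder (f curve (peripheral p q)) : ℤ) = 2 * |p + 4 * q| :=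
  r.poleOrder_f p q (r.val_ell hr)

theorem poleOrder_f_place_neg {r : Branch} (hr : r.sign = -1) (p q : ℤ) :
    ((-r).place.poleOrder (f curve (peripheral p q)) : ℤ) = 2 * |p - 4 * q| := by
  rw [(-r).poleOrder_f p q (m := -4) (by rw [← r.ell_inv, map_inv₀, r.val_ell hr, exp_neg]),
    neg_mul, ← sub_eq_add_neg]

theorem isCullerShalenNorm_cullerShalenNorm : IsCullerShalenNorm curve cullerShalenNorm where
  definite := eq_zero_of_cullerShalenNorm_eq_zero
  eq_degree p q := by
    obtain ⟨r, hr⟩ := exists_branch_sign_eq_neg_one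
    have h1 := congrArg (Int.cast : ℤ → ℝ) (poleOrder_f_place hr p q)
    have h2 := congrArg (Int.cast : ℤ → ℝ) (poleOrder_f_place_neg hr p q)
    push_cast at h1 h2
    rw [meromorphicDegree_f r, cullerShalenNorm_apply, Nat.cast_add, h1, h2]
    ring

end FigureEight

end

theorem proposition4p9 :
    ∃ X₀ : AffineVariety 3,
      X₀.carrier = {v | v 0 = v 1 ∧ v 2 ^ 2 - (1 + v 0 ^ 2) * v 2 + 2 * v 0 ^ 2 - 1 = 0} ∧
      X₀.IsComponentOf FigureEight.characterVariety ∧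
      (∀ ρ : FigureEight.KnotGroup →* FigureEight.SL2, FigureEight.IsDiscreteFaithful ρ →
        FigureEight.character ρ ∈ X₀.carrier ∧
        ∀ Y : AffineVariety 3, Y.IsComponentOf FigureEight.characterVariety →
          FigureEight.character ρ ∈ Y.carrier → Y.carrier = X₀.carrier) ∧
      (∃ P₀ P₁ : Place X₀.FunctionField, P₀ ≠ P₁ ∧
        {P | X₀.IsIdealPoint P} = {P₀, P₁} ∧
        ∀ p q : ℤ,
          (P₀.poleOrder (FigureEight.f X₀ (FigureEight.peripheral p q)) : ℤ) = 2 * |p + 4 * q| ∧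
          (P₁.poleOrder (FigureEight.f X₀ (FigureEight.peripheral p q)) : ℤ) = 2 * |p - 4 * q|) ∧
      ∃ N : Seminorm ℝ (ℝ × ℝ),
        FigureEight.IsCullerShalenNorm X₀ N ∧
        (∀ N' : Seminorm ℝ (ℝ × ℝ), FigureEight.IsCullerShalenNorm X₀ N' → N' = N) ∧
        ∀ p q : ℤ, N ((p : ℝ), (q : ℝ)) = 2 * (|(p : ℝ) + 4 * q| + |(p : ℝ) - 4 * q|) := by
  obtain ⟨r, hr⟩ := FigureEight.exists_branch_sign_eq_neg_one
  refine ⟨FigureEight.curve, rfl, FigureEight.curve_isComponentOf,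
    fun ρ hρ => FigureEight.eq_curve_of_isDiscreteFaithful hρ,
    ⟨r.place, (-r).place, r.place_ne_place_neg, FigureEight.setOf_isIdealPoint r, fun p q =>
      ⟨FigureEight.poleOrder_f_place hr p q, FigureEight.poleOrder_f_place_neg hr p q⟩⟩,
    FigureEight.cullerShalenNorm, FigureEight.isCullerShalenNorm_cullerShalenNorm,
    fun N' hN' => FigureEight.seminorm_eq_of_forall_int fun p q => ?_,
    fun p q => FigureEight.cullerShalenNorm_apply _⟩
  rw [hN'.eq_degree, FigureEight.isCullerShalenNorm_cullerShalenNorm.eq_degree]
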